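/- Let $T\in\mathbb{N}$, $T\ge 1$, $p\in(1,\infty)$ and $q=p/(p-1)$. Let $X$ be the identity (canonical process) on $\mathbb{R}^T$, $\mathcal{F}^X_t=\sigma(X_1,\dots,X_t)$, and let $\mathcal{P}_p(\mathbb{R}^T)$ be the set of Borel probability measures on $\mathbb{R}^T$ with finite $p$-th moment. A coupling $\pi$ of $P$ and $Q$ (a probability measure on $\mathbb{R}^T\times\mathbb{R}^T$ with marginals $P$ and $Q$; write $X,Y$ for the two coordinate projections) is called causal if for every $1\le t\le T$ and every Borel set $A\subseteq\mathbb{R}^t$, $\pi((Y_1,\dots,Y_t)\in A\mid X_1,\dots,X_T)=\pi((Y_1,\dots,Y_t)\in A\mid X_1,\dots,X_t)$ $\pi$-almost surely, and bicausal if the same also holds with the roles of $X$ and $Y$ exchanged. Let $$\mathcal{AW}_p(P,Q)=\inf_{\pi}\Big(\sum_{t=1}^T E_\pi\big[|X_t-Y_t|^p\big]\Big)^{1/p},$$ the infimum being over all bicausal couplings of $P$ and $Q$, and let $B_r(P)=\{Q\in\mathcal{P}_p(\mathbb{R}^T):\mathcal{AW}_p(P,Q)\le r\}$ for $r\geq 0$.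 Let $f\colon\mathbb{R}^T\times\{1,\dots,T\}\to\mathbb{R}$ be such that $f(X,t)$ is $\mathcal{F}^X_t$-measurable for every $t$, and put $s(Q)=\inf_{\tau\in\mathrm{ST}}E_Q[f(X,\tau)]$, where $\mathrm{ST}$ is the set of all $\tau\colon\mathbb{R}^T\to\{1,\dots,T\}$ with $\{\tau\le t\}\in\mathcal{F}^X_t$ for every $t$. Let $P\in\mathcal{P}_p(\mathbb{R}^T)$. Assume that $f(\cdot,t)$ is continuously differentiable for every $t$, that there is a constant $c>0$ with $$\sum_{s=1}^T|\partial_{x_s}f(x,t)|\le c\Big(1+\sum_{s=1}^T|x_s|^{p-1}\Big)\qquad\text{for all }x\in\mathbb{R}^T,\ t=1,\dots,T,$$ and that there is exactly one (up to $P$-almost sure equality) optimal stopping time $\tau^\ast\in\mathrm{ST}$ for $s(P)$, i.e. with $E_P[f(X,\tau^\ast)]=s(P)$. Then all the expectations, infima and suprema below are well defined and finite: for every $Q\in\mathcal{P}_p(\mathbb{R}^T)$, $f(X,\tau)$ is $Q$-integrable for each $\tau\in\mathrm{ST}$ and $s(Q)>-\infty$; $\sup_{Q\in B_r(P)}s(Q)<\infty$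 for every $r\ge0$; and, for each $t$, $\partial_{x_t}f(X,\tau^\ast)$ and $|E_P[\partial_{x_t}f(X,\tau^\ast)\mid\mathcal{F}^X_t]|^q$ are $P$-integrable. Moreover, as $r\downarrow0$, $$\sup_{Q\in B_r(P)}s(Q)=s(P)+r\cdot\Big(\sum_{t=1}^T E_P\Big[\big|E_P[\partial_{x_t}f(X,\tau^\ast)\mid\mathcal{F}^X_t]\big|^q\Big]\Big)^{1/q}+o(r).$$ -/

import Mathlib

open MeasureTheory ProbabilityTheory Filter Topology Asymptotics
open scoped ENNReal

noncomputable section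

namespace AdaptedStopping

/-- The path space `ℝ^T`; the time index `1, …, T` of the mathematical text is `Fin T`. -/
abbrev Path (T : ℕ) : Type := Fin T → ℝ

/-- The canonical filtration `F_t = σ(X_s : s ≤ t)` on the path space. -/
abbrev canonicalFiltration (T : ℕ) :
    Filtration (Fin T) (inferInstance : MeasurableSpace (Path T)) :=
  Filtration.piLE (X := fun _ : Fin T => ℝ)

/-- Borel probability measures on `ℝ^T` with finite `p`-th moment. -/
def finiteMomentLaws (T : ℕ) (p : ℝ) : Set (Measure (Path T)) :=
  {P | IsProbabilityMeasure P ∧ MemLp (fun x : Path T => x) (ENNReal.ofReal p) P}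

/-- Couplings of `P` and `Q`. -/
def IsCoupling {T : ℕ} (P Q : Measure (Path T)) (π : Measure (Path T × Path T)) : Prop :=
  π.map Prod.fst = P ∧ π.map Prod.snd = Q

/-- Causality: almost surely, for every `t` and every Borel set `A ⊆ ℝ^t`,
`π((Y_1, …, Y_t) ∈ A | X_1, …, X_T) = π((Y_1, …, Y_t) ∈ A | X_1, …, X_t)`. -/
def IsCausal {T : ℕ} (π : Measure (Path T × Path T)) : Prop :=
  ∀ (t : Fin T) (A : Set (Set.Iic t → ℝ)), MeasurableSet A →
    π⟦{z : Path T × Path T | (fun s : Set.Iic t => z.2 s) ∈ A} |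
        MeasurableSpace.comap Prod.fst (inferInstance : MeasurableSpace (Path T))⟧
      =ᵐ[π]
    π⟦{z : Path T × Path T | (fun s : Set.Iic t => z.2 s) ∈ A} |
        MeasurableSpace.comap Prod.fst (canonicalFiltration T t)⟧

/-- Bicausality: causality, also with the roles of the two coordinates exchanged. -/
def IsBicausal {T : ℕ} (π : Measure (Path T × Path T)) : Prop :=
  IsCausal π ∧ IsCausal (π.map Prod.swap)

/-- The transport cost `(∑_t E_π |X_t - Y_t|^p)^{1/p}`. -/
def transportCost {T : ℕ} (p : ℝ) (π : Measure (Path T × Path T)) : ℝ≥0∞ :=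
  (∑ t : Fin T, ∫⁻ z, ENNReal.ofReal (|z.1 t - z.2 t| ^ p) ∂π) ^ (1 / p)

/-- The adapted Wasserstein distance `AW_p`. -/
def adaptedWasserstein {T : ℕ} (p : ℝ) (P Q : Measure (Path T)) : ℝ≥0∞ :=
  ⨅ (π : Measure (Path T × Path T)) (_ : IsCoupling P Q π ∧ IsBicausal π), transportCost p π

/-- The ball `B_r(P)`. -/
def adaptedBall {T : ℕ} (p : ℝ) (P : Measure (Path T)) (r : ℝ) : Set (Measure (Path T)) :=
  {Q | Q ∈ finiteMomentLaws T p ∧ adaptedWasserstein p P Q ≤ ENNReal.ofReal r}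

/-- The set `ST` of stopping times with values in `{1, …, T}` for the canonical filtration. -/
def stoppingTimes (T : ℕ) : Set (Path T → Fin T) :=
  {τ | IsStoppingTime (canonicalFiltration T) (fun x => (τ x : WithTop (Fin T)))}

/-- The value `s(Q) = inf_{τ ∈ ST} E_Q[f(X, τ)]`. -/
def stoppingValue {T : ℕ} (f : Path T → Fin T → ℝ) (Q : Measure (Path T)) : ℝ :=
  ⨅ τ : stoppingTimes T, ∫ x, f x (τ.1 x) ∂Q

/-- `τ` is an optimal stopping time for `s(P)`. -/
def IsOptimalStoppingTime {T : ℕ} (f : Path T → Fin T → ℝ) (P : Measure (Path T))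
    (τ : Path T → Fin T) : Prop :=
  τ ∈ stoppingTimes T ∧ ∫ x, f x (τ x) ∂P = stoppingValue f P

/-- The partial derivative `∂_{x_s} f(x, t)`. -/
def partialDeriv {T : ℕ} (f : Path T → Fin T → ℝ) (s : Fin T) (x : Path T) (t : Fin T) : ℝ :=
  lineDeriv ℝ (fun y : Path T => f y t) x (Pi.single s 1)

/-- The conditional expectation `E_P[∂_{x_t} f(X, τ) | F_t]`. -/
def projectedDeriv {T : ℕ} (f : Path T → Fin T → ℝ) (P : Measure (Path T))
    (τ : Path T → Fin T) (t : Fin T) : Path T → ℝ :=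
  P[fun x => partialDeriv f t x (τ x) | canonicalFiltration T t]

end AdaptedStopping

end

/-!
The value `s` of optimal stopping is differentiated at `P` along balls of the adapted Wasserstein
distance. Both inequalities rest on one uniform Taylor estimate
(`exists_integral_remainder_le`): if `X` has law `P` and is displaced by `Δ` with small `L^p` size,
the first-order remainder of `E[f(X + Δ, κ)]` is negligible with respect to that size, whatever the
random exercise date `κ`.

*Upper bound* (`exists_stoppingValue_le`). Let `π` be a bicausal coupling of `P` and `Q` with almost
minimal cost. Causality from `Y` to `X` makes `τ*(X)` a randomised stopping time for `Y`, and
randomisation does not lower the value (`stoppingValue_le_sum_weights`,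
`stoppingValue_le_of_isCausal`), so `s(Q) ≤ E_π[f(Y, τ*(X))]`. The first-order term of the right-hand
side is `∑_t E_π[∂_t f(X, τ*) (Y_t - X_t)]`. Causality from `X` to `Y` allows each `∂_t f(X, τ*)` to be
replaced by its projection `E_P[∂_t f(X, τ*) | F_t]` (`IsCausal.integral_mul_sub_eq`), and Hölder's
inequality gives the coefficient.

*Lower bound* (`exists_le_stoppingValue`). The direction that attains equality in Hölder's
inequality is adapted, and is approximated by an adapted direction `Z_t = z_t(X_1, …, X_t)` with
Lipschitz `z_t` (`exists_lipschitz_direction`). For small `r` the map `x ↦ x + r Z(x)` is adapted and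
injective on paths up to each time, hence the coupling of `X` with `X + r Z` is bicausal
(`isBicausal_perturb`). A stopping time of `X + r Z` is a stopping time of `X`. If it is far from
optimal, the zeroth-order term already suffices. Otherwise uniqueness of `τ*` forces it to agree
with `τ*` outside a small set (`exists_integral_ne_lt`), so that the first-order term is close to
that of `τ*`. This stability is proved without the Snell envelope: since
`f(x, τ ∧ σ) + f(x, τ ∨ σ) = f(x, τ) + f(x, σ)`, lower and upper limits of a fast minimising sequence
of stopping times are again optimal.
-/

noncomputable section

namespace AdaptedStopping

/-! ### Growth, integrability and the first-order Taylor estimate -/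

/-- The (Fréchet) derivative of the payoff `f(·, k)` at the path `x`. -/
def pathDeriv {T : ℕ} (f : Path T → Fin T → ℝ) (k : Fin T) (x : Path T) : Path T →L[ℝ] ℝ :=
  fderiv ℝ (fun y : Path T => f y k) x

lemma rpow_sub_one_mul_self {p t : ℝ} (hp : 1 < p) (ht : 0 ≤ t) : t ^ (p - 1) * t = t ^ p := by
  rcases ht.eq_or_lt with rfl | h
  · rw [Real.zero_rpow (by linarith : p ≠ 0), mul_zero]
  · rw [Real.rpow_sub_one h.ne']; field_simp

lemma le_one_add_rpow {s t : ℝ} (hs : 1 ≤ s) (ht : 0 ≤ t) : t ≤ 1 + t ^ s := by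
  rcases le_total t 1 with h | h
  · linarith [Real.rpow_nonneg ht s]
  · linarith [Real.self_le_rpow_of_one_le h hs]

lemma add_rpow_le_two_rpow {s a b : ℝ} (hs : 0 ≤ s) (ha : 0 ≤ a) (hb : 0 ≤ b) :
    (a + b) ^ s ≤ 2 ^ s * (a ^ s + b ^ s) := by
  have h1 : a + b ≤ 2 * max a b := by
    linarith [le_max_left a b, le_max_right a b]
  have hm : 0 ≤ max a b := ha.trans (le_max_left _ _)
  calc (a + b) ^ s ≤ (2 * max a b) ^ s := Real.rpow_le_rpow (by positivity) h1 hs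
    _ = 2 ^ s * (max a b) ^ s := Real.mul_rpow (by norm_num) hm
    _ ≤ 2 ^ s * (a ^ s + b ^ s) := by
        gcongr
        rcases max_choice a b with h | h <;> rw [h]
        · linarith [Real.rpow_nonneg hb s]
        · linarith [Real.rpow_nonneg ha s]

section Growth

variable {T : ℕ} {p : ℝ} {f : Path T → Fin T → ℝ} {C : ℝ}

lemma partialDeriv_eq (hC1 : ∀ t : Fin T, ContDiff ℝ 1 (fun x => f x t)) (s k : Fin T)
    (x : Path T) : partialDeriv f s x k = pathDeriv f k x (Pi.single s 1) :=
  (((hC1 k).differentiable (by norm_num)) x).lineDeriv_eq_fderiv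

lemma pathDeriv_apply (hC1 : ∀ t : Fin T, ContDiff ℝ 1 (fun x => f x t)) (k : Fin T)
    (x v : Path T) : pathDeriv f k x v = ∑ s, partialDeriv f s x k * v s := by
  conv_lhs => rw [pi_eq_sum_univ' v]
  rw [map_sum]
  refine Finset.sum_congr rfl fun s _ => ?_
  rw [map_smul, partialDeriv_eq hC1, smul_eq_mul, mul_comm]

lemma continuous_pathDeriv (hC1 : ∀ t : Fin T, ContDiff ℝ 1 (fun x => f x t)) (k : Fin T) :
    Continuous (pathDeriv f k) :=
  (hC1 k).continuous_fderiv (by norm_num)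

/-- The growth condition on the partial derivatives bounds the operator norm of the derivative. -/
lemma exists_norm_pathDeriv_le (hp : 1 < p)
    (hC1 : ∀ t : Fin T, ContDiff ℝ 1 (fun x => f x t))
    (hf_growth : ∃ c : ℝ, 0 < c ∧ ∀ (x : Path T) (t : Fin T),
      ∑ s : Fin T, |partialDeriv f s x t| ≤ c * (1 + ∑ s : Fin T, |x s| ^ (p - 1))) :
    ∃ C : ℝ, 0 ≤ C ∧ ∀ k x, ‖pathDeriv f k x‖ ≤ C * (1 + ‖x‖ ^ (p - 1)) := by
  obtain ⟨c, hc, h⟩ := hf_growth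
  refine ⟨c * (1 + T), by positivity, fun k x => ?_⟩
  have hx : 0 ≤ ‖x‖ ^ (p - 1) := by positivity
  have h1 : ∑ s : Fin T, |x s| ^ (p - 1) ≤ T * ‖x‖ ^ (p - 1) := by
    calc ∑ s : Fin T, |x s| ^ (p - 1) ≤ ∑ _s : Fin T, ‖x‖ ^ (p - 1) := by
          gcongr with s
          exact norm_le_pi_norm x s
      _ = _ := by simp
  refine ContinuousLinearMap.opNorm_le_bound _ (by positivity) fun v => ?_
  rw [pathDeriv_apply hC1, Real.norm_eq_abs]
  calc |∑ s, partialDeriv f s x k * v s| ≤ ∑ s, |partialDeriv f s x k| * ‖v‖ := by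
        refine (Finset.abs_sum_le_sum_abs _ _).trans ?_
        gcongr with s
        rw [abs_mul]
        gcongr
        exact norm_le_pi_norm v s
    _ = (∑ s, |partialDeriv f s x k|) * ‖v‖ := by rw [Finset.sum_mul]
    _ ≤ (c * (1 + ∑ s : Fin T, |x s| ^ (p - 1))) * ‖v‖ := by gcongr; exact h x k
    _ ≤ (c * (1 + T) * (1 + ‖x‖ ^ (p - 1))) * ‖v‖ := by
        refine mul_le_mul_of_nonneg_right ?_ (norm_nonneg v)
        rw [mul_assoc]
        refine mul_le_mul_of_nonneg_left ?_ hc.le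
        nlinarith [Nat.cast_nonneg (α := ℝ) T]

/-- Under the growth condition on its derivative the payoff grows at most like the `p`-th power. -/
lemma exists_abs_le (hp : 1 < p) (hC1 : ∀ t : Fin T, ContDiff ℝ 1 (fun x => f x t))
    (hC : 0 ≤ C) (hG : ∀ k x, ‖pathDeriv f k x‖ ≤ C * (1 + ‖x‖ ^ (p - 1))) :
    ∃ M : ℝ, 0 ≤ M ∧ ∀ x k, |f x k| ≤ M * (1 + ‖x‖ ^ p) := by
  refine ⟨∑ k, |f 0 k| + 2 * C, by positivity, fun x k => ?_⟩
  have hx : 0 ≤ ‖x‖ ^ p := by positivity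
  have h0 : |f 0 k| ≤ ∑ k, |f 0 k| :=
    Finset.single_le_sum (f := fun k => |f 0 k|) (fun _ _ => abs_nonneg _) (Finset.mem_univ k)
  have hmv : ‖f x k - f 0 k‖ ≤ C * (1 + ‖x‖ ^ (p - 1)) * ‖x - 0‖ := by
    refine (convex_closedBall (0 : Path T) ‖x‖).norm_image_sub_le_of_norm_fderiv_le
      (f := fun y => f y k) (fun y _ => ((hC1 k).differentiable (by norm_num)) y)
      (fun y hy => ?_) (by simp) (by simp)
    have hy' : ‖y‖ ≤ ‖x‖ := by simpa using hy
    refine (hG k y).trans ?_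
    gcongr
  rw [sub_zero, Real.norm_eq_abs, mul_assoc, add_mul, one_mul,
    rpow_sub_one_mul_self hp (norm_nonneg _)] at hmv
  have h2 := le_one_add_rpow hp.le (norm_nonneg x)
  have h3 : |f x k| ≤ |f x k - f 0 k| + |f 0 k| := by
    simpa using abs_add_le (f x k - f 0 k) (f 0 k)
  have h4 : C * (‖x‖ + ‖x‖ ^ p) ≤ C * (2 * (1 + ‖x‖ ^ p)) := by
    gcongr; linarith
  have h5 : |f 0 k| ≤ (∑ k, |f 0 k|) * (1 + ‖x‖ ^ p) :=
    h0.trans (le_mul_of_one_le_right (by positivity) (by linarith))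
  calc |f x k| ≤ C * (2 * (1 + ‖x‖ ^ p)) + (∑ k, |f 0 k|) * (1 + ‖x‖ ^ p) := by linarith
    _ = _ := by ring

/-- First-order Taylor estimate. The remainder is `‖y - x‖` times a factor that is small where
`‖x‖ ≤ R` and `‖y - x‖` is small, by uniform continuity of the derivative on a ball. Elsewhere the
growth condition applies; the tail term in `x` carries a constant that depends neither on `ε` nor
on `R`, so that it can be made small by choosing `R` large. -/
lemma exists_taylor_bound (hp : 1 < p) (hC1 : ∀ t : Fin T, ContDiff ℝ 1 (fun x => f x t))
    (hC : 0 ≤ C) (hG : ∀ k x, ‖pathDeriv f k x‖ ≤ C * (1 + ‖x‖ ^ (p - 1)))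
    {ε R : ℝ} (hε : 0 < ε) (hR : 0 ≤ R) :
    ∃ K : ℝ, 0 ≤ K ∧ ∀ x y k, |f y k - f x k - pathDeriv f k x (y - x)| ≤
      ‖y - x‖ * (ε + K * ‖y - x‖ ^ (p - 1) +
        Set.indicator {x : Path T | R < ‖x‖}
          (fun x => C * (2 + 2 ^ (p - 1)) * (1 + ‖x‖ ^ (p - 1))) x) := by
  set A := C * (2 + 2 ^ (p - 1)) with hA
  have hA0 : 0 ≤ A := by positivity
  have hp1 : 0 ≤ p - 1 := by linarith
  -- one modulus of continuity for all exercise dates: regard the derivatives as a single map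
  have huc : UniformContinuousOn (fun x : Path T => fun k : Fin T => pathDeriv f k x)
      (Metric.closedBall 0 (R + 1)) :=
    (isCompact_closedBall _ _).uniformContinuousOn_of_continuous
      (continuous_pi fun k => continuous_pathDeriv hC1 k).continuousOn
  obtain ⟨δ, hδ, hδε⟩ := Metric.uniformContinuousOn_iff.1 huc ε hε
  set d := min (δ / 2) 1 with hd
  have hd0 : 0 < d := by positivity
  refine ⟨A + A * (1 + R ^ (p - 1)) / d ^ (p - 1), by positivity, fun x y k => ?_⟩
  rw [mul_comm]
  have hsup : ∀ z : Path T, ‖z - x‖ ≤ ‖y - x‖ →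
      ‖pathDeriv f k z - pathDeriv f k x‖ ≤ A * (1 + ‖x‖ ^ (p - 1)) + A * ‖y - x‖ ^ (p - 1) := by
    intro z hz
    have hz' : ‖z‖ ≤ ‖x‖ + ‖y - x‖ := by
      calc ‖z‖ = ‖x + (z - x)‖ := by congr 1; abel
        _ ≤ ‖x‖ + ‖z - x‖ := norm_add_le _ _
        _ ≤ _ := by gcongr
    have h1 : ‖z‖ ^ (p - 1) ≤ 2 ^ (p - 1) * (‖x‖ ^ (p - 1) + ‖y - x‖ ^ (p - 1)) :=
      (Real.rpow_le_rpow (norm_nonneg _) hz' hp1).trans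
        (add_rpow_le_two_rpow hp1 (norm_nonneg _) (norm_nonneg _))
    have hu : 0 ≤ ‖x‖ ^ (p - 1) := by positivity
    have hv : 0 ≤ ‖y - x‖ ^ (p - 1) := by positivity
    have hw : (0:ℝ) ≤ 2 ^ (p - 1) := by positivity
    calc ‖pathDeriv f k z - pathDeriv f k x‖ ≤ ‖pathDeriv f k z‖ + ‖pathDeriv f k x‖ :=
          norm_sub_le _ _
      _ ≤ C * (1 + 2 ^ (p - 1) * (‖x‖ ^ (p - 1) + ‖y - x‖ ^ (p - 1)))
          + C * (1 + ‖x‖ ^ (p - 1)) := by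
          gcongr
          · exact (hG k z).trans (by gcongr)
          · exact hG k x
      _ ≤ _ := by
          rw [hA, ← sub_nonneg]
          have : 0 ≤ C * (2 ^ (p - 1) + ‖x‖ ^ (p - 1) + 2 * ‖y - x‖ ^ (p - 1)) := by positivity
          refine this.trans (le_of_eq ?_)
          ring
  have hball : Convex ℝ (Metric.closedBall x ‖y - x‖) := convex_closedBall _ _
  refine hball.norm_image_sub_le_of_norm_fderiv_le' (𝕜 := ℝ) (f := fun y => f y k)
    (φ := pathDeriv f k x) (fun z _ => ((hC1 k).differentiable (by norm_num)) z)
    (fun z hz => ?_) (by simp) (by simp [dist_eq_norm])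
  have hz' : ‖z - x‖ ≤ ‖y - x‖ := by simpa [dist_eq_norm] using hz
  change ‖pathDeriv f k z - pathDeriv f k x‖ ≤ _
  have hv : 0 ≤ ‖y - x‖ ^ (p - 1) := by positivity
  have hq : 0 ≤ A * (1 + R ^ (p - 1)) / d ^ (p - 1) := by positivity
  by_cases hxR : R < ‖x‖
  · rw [Set.indicator_of_mem (by exact hxR)]
    refine (hsup z hz').trans ?_
    nlinarith
  rw [Set.indicator_of_notMem (by exact hxR), add_zero]
  push Not at hxR
  by_cases hyd : ‖y - x‖ ≤ d
  · have h1 : ‖z - x‖ < δ := by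
      have := min_le_left (δ / 2) 1
      linarith
    have h2 : ‖z‖ ≤ R + 1 := by
      have h3 : ‖z‖ ≤ ‖x‖ + ‖z - x‖ := by
        calc ‖z‖ = ‖x + (z - x)‖ := by congr 1; abel
          _ ≤ _ := norm_add_le _ _
      have := min_le_right (δ / 2) 1
      linarith
    have h3 := hδε z (by simpa using h2) x (by simp; linarith) (by rwa [dist_eq_norm])
    have h4 := (dist_pi_lt_iff hε).1 h3 k
    rw [dist_eq_norm] at h4
    have : 0 ≤ (A + A * (1 + R ^ (p - 1)) / d ^ (p - 1)) * ‖y - x‖ ^ (p - 1) := by positivity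
    linarith
  · push Not at hyd
    refine (hsup z hz').trans ?_
    have h1 : 1 ≤ ‖y - x‖ ^ (p - 1) / d ^ (p - 1) := by
      rw [one_le_div (by positivity)]
      exact Real.rpow_le_rpow hd0.le hyd.le hp1
    have h2 : ‖x‖ ^ (p - 1) ≤ R ^ (p - 1) := Real.rpow_le_rpow (norm_nonneg _) hxR hp1
    calc A * (1 + ‖x‖ ^ (p - 1)) + A * ‖y - x‖ ^ (p - 1)
        ≤ A * (1 + R ^ (p - 1)) * (‖y - x‖ ^ (p - 1) / d ^ (p - 1)) + A * ‖y - x‖ ^ (p - 1) := by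
          refine add_le_add ?_ le_rfl
          calc A * (1 + ‖x‖ ^ (p - 1)) ≤ A * (1 + R ^ (p - 1)) := by gcongr
            _ ≤ _ := le_mul_of_one_le_right (by positivity) h1
      _ ≤ _ := by
          have : A * (1 + R ^ (p - 1)) * (‖y - x‖ ^ (p - 1) / d ^ (p - 1)) =
            A * (1 + R ^ (p - 1)) / d ^ (p - 1) * ‖y - x‖ ^ (p - 1) := by ring
          rw [this]
          linarith

end Growth

lemma measurable_eval_index {ι α Ω β : Type*} [Countable ι] [MeasurableSpace ι]
    [MeasurableSingletonClass ι] [MeasurableSpace α] [MeasurableSpace Ω] [MeasurableSpace β]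
    {g : ι → α → β} (hg : ∀ k, Measurable (g k)) {X : Ω → α} (hX : Measurable X)
    {κ : Ω → ι} (hκ : Measurable κ) : Measurable fun ω => g (κ ω) (X ω) :=
  (measurable_from_prod_countable_right (f := fun z : ι × α => g z.1 z.2) hg).comp (hκ.prodMk hX)

section Integrability

variable {T : ℕ} {p q : ℝ} {f : Path T → Fin T → ℝ} {C : ℝ}
variable {Ω : Type*} [MeasurableSpace Ω] {μ : Measure Ω}

lemma integrable_mul_of_holderConjugate (hpq : p.HolderConjugate q) {g h : Ω → ℝ}
    (hg : MemLp g (ENNReal.ofReal p) μ) (hh : MemLp h (ENNReal.ofReal q) μ) :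
    Integrable (fun ω => g ω * h ω) μ := by
  have : ENNReal.HolderConjugate (ENNReal.ofReal p) (ENNReal.ofReal q) := hpq.ennrealOfReal
  exact hg.integrable_mul hh

lemma integrable_norm_rpow {E : Type*} [NormedAddCommGroup E] (hp : 0 < p) {X : Ω → E}
    (hX : MemLp X (ENNReal.ofReal p) μ) : Integrable (fun ω => ‖X ω‖ ^ p) μ := by
  have := hX.integrable_norm_rpow (by simpa using hp) ENNReal.ofReal_ne_top
  rwa [ENNReal.toReal_ofReal hp.le] at this

lemma memLp_one_add_norm_rpow [IsFiniteMeasure μ] (hpq : p.HolderConjugate q) {X : Ω → Path T}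
    (hX : MemLp X (ENNReal.ofReal p) μ) :
    MemLp (fun ω => 1 + ‖X ω‖ ^ (p - 1)) (ENNReal.ofReal q) μ := by
  have h := hX.norm_rpow_div (ENNReal.ofReal (p - 1))
  have hexp : ENNReal.ofReal p / ENNReal.ofReal (p - 1) = ENNReal.ofReal q := by
    rw [← ENNReal.ofReal_div_of_pos hpq.sub_one_pos, ← hpq.conjugate_eq]
  rw [ENNReal.toReal_ofReal hpq.sub_one_pos.le, hexp] at h
  have h1 : MemLp (fun _ : Ω => (1 : ℝ)) (ENNReal.ofReal q) μ := memLp_const 1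
  exact h1.add h

lemma integrable_payoff [IsFiniteMeasure μ] (hp : 1 < p)
    (hC1 : ∀ t : Fin T, ContDiff ℝ 1 (fun x => f x t)) (hC : 0 ≤ C)
    (hG : ∀ k x, ‖pathDeriv f k x‖ ≤ C * (1 + ‖x‖ ^ (p - 1)))
    {X : Ω → Path T} (hXm : Measurable X) (hX : MemLp X (ENNReal.ofReal p) μ)
    {κ : Ω → Fin T} (hκ : Measurable κ) : Integrable (fun ω => f (X ω) (κ ω)) μ := by
  obtain ⟨M, hM, hb⟩ := exists_abs_le hp hC1 hC hG
  refine Integrable.mono' (((integrable_const (1 : ℝ)).add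
    (integrable_norm_rpow (by linarith) hX)).const_mul M)
    (measurable_eval_index (g := fun k x => f x k) (fun k => (hC1 k).continuous.measurable)
      hXm hκ).aestronglyMeasurable (ae_of_all _ fun ω => hb _ _)

lemma measurable_pathDeriv_apply (hC1 : ∀ t : Fin T, ContDiff ℝ 1 (fun x => f x t))
    {X V : Ω → Path T} (hX : Measurable X) (hV : Measurable V) {κ : Ω → Fin T}
    (hκ : Measurable κ) : Measurable fun ω => pathDeriv f (κ ω) (X ω) (V ω) :=
  measurable_eval_index (g := fun k (z : Path T × Path T) => pathDeriv f k z.1 z.2)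
    (fun k => (((continuous_pathDeriv hC1 k).comp continuous_fst).clm_apply
      continuous_snd).measurable) (hX.prodMk hV) hκ

lemma integrable_pathDeriv_apply [IsFiniteMeasure μ] (hpq : p.HolderConjugate q)
    (hC1 : ∀ t : Fin T, ContDiff ℝ 1 (fun x => f x t))
    (hG : ∀ k x, ‖pathDeriv f k x‖ ≤ C * (1 + ‖x‖ ^ (p - 1)))
    {X V : Ω → Path T} (hXm : Measurable X) (hX : MemLp X (ENNReal.ofReal p) μ)
    (hVm : Measurable V) (hV : MemLp V (ENNReal.ofReal p) μ)
    {κ : Ω → Fin T} (hκ : Measurable κ) :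
    Integrable (fun ω => pathDeriv f (κ ω) (X ω) (V ω)) μ := by
  refine Integrable.mono' (integrable_mul_of_holderConjugate hpq hV.norm
    ((memLp_one_add_norm_rpow hpq hX).const_mul C))
    (measurable_pathDeriv_apply hC1 hXm hVm hκ).aestronglyMeasurable (ae_of_all _ fun ω => ?_)
  rw [mul_comm]
  exact ((pathDeriv f (κ ω) (X ω)).le_opNorm _).trans
    (mul_le_mul_of_nonneg_right (hG _ _) (norm_nonneg _))

end Integrability

section Remainder

variable {T : ℕ} {p q : ℝ} {f : Path T → Fin T → ℝ} {C : ℝ} {P : Measure (Path T)}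

/-- The tails of `1 + ‖x‖^{p-1}` are small in `L^q(P)`. -/
lemma exists_tail_le [IsFiniteMeasure P] (hpq : p.HolderConjugate q)
    (hP : MemLp (fun x : Path T => x) (ENNReal.ofReal p) P) (A : ℝ) {ε : ℝ} (hε : 0 < ε) :
    ∃ R : ℝ, 0 ≤ R ∧ (∫ x, (Set.indicator {x : Path T | R < ‖x‖}
      (fun x => |A| * (1 + ‖x‖ ^ (p - 1))) x) ^ q ∂P) ^ (1 / q) ≤ ε := by
  have hq : 0 < q := hpq.symm.pos
  set g : Path T → ℝ := fun x => |A| * (1 + ‖x‖ ^ (p - 1)) with hg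
  have hgq : MemLp g (ENNReal.ofReal q) P := (memLp_one_add_norm_rpow hpq hP).const_mul |A|
  have hg0 : ∀ x, 0 ≤ g x := fun x => by positivity
  have hgm : Measurable g := by fun_prop
  have hgi : Integrable (fun x => g x ^ q) P := by
    simpa [abs_of_nonneg (hg0 _)] using integrable_norm_rpow hq hgq
  have hlim : Tendsto (fun n : ℕ => ∫ x, (Set.indicator {x : Path T | (n : ℝ) < ‖x‖} g x) ^ q ∂P)
      atTop (𝓝 (∫ _x, (0 : ℝ) ∂P)) := by
    refine tendsto_integral_of_dominated_convergence (fun x => g x ^ q) (fun n => ?_) hgi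
      (fun n => ae_of_all _ fun x => ?_) (ae_of_all _ fun x => ?_)
    · exact ((hgm.indicator (measurableSet_lt measurable_const
        measurable_norm)).pow_const q).aestronglyMeasurable
    · have h0 : 0 ≤ Set.indicator {x : Path T | (n : ℝ) < ‖x‖} g x :=
        Set.indicator_nonneg (fun x _ => hg0 x) x
      rw [Real.norm_of_nonneg (Real.rpow_nonneg h0 q)]
      exact Real.rpow_le_rpow h0 (Set.indicator_le_self' (fun x _ => hg0 x) x) hq.le
    · refine tendsto_const_nhds.congr' ?_
      filter_upwards [eventually_ge_atTop ⌈‖x‖⌉₊] with n hn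
      rw [Set.indicator_of_notMem, Real.zero_rpow hq.ne']
      simpa using Nat.ceil_le.1 hn
  rw [integral_zero] at hlim
  have hlim2 := hlim.rpow_const (p := 1 / q) (Or.inr (by positivity))
  rw [Real.zero_rpow (by positivity)] at hlim2
  obtain ⟨n, hn⟩ := (hlim2.eventually (eventually_le_nhds hε)).exists
  exact ⟨n, by positivity, hn⟩

/-- The first-order remainder of the payoff under a small displacement of `X` is, in expectation,
negligible with respect to the `L^p` size of the displacement, uniformly over all displacements
(on any probability space) and over all random exercise dates. -/
theorem exists_integral_remainder_le [IsProbabilityMeasure P] (hpq : p.HolderConjugate q)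
    (hC1 : ∀ t : Fin T, ContDiff ℝ 1 (fun x => f x t)) (hC : 0 ≤ C)
    (hG : ∀ k x, ‖pathDeriv f k x‖ ≤ C * (1 + ‖x‖ ^ (p - 1)))
    (hP : MemLp (fun x : Path T => x) (ENNReal.ofReal p) P) {ε : ℝ} (hε : 0 < ε) :
    ∃ δ : ℝ, 0 < δ ∧ ∀ {Ω : Type} [MeasurableSpace Ω] (μ : Measure Ω) [IsProbabilityMeasure μ]
      (X Y : Ω → Path T) (κ : Ω → Fin T), Measurable X → Measurable Y → Measurable κ →
      μ.map X = P → MemLp (fun ω => Y ω - X ω) (ENNReal.ofReal p) μ →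
      (∫ ω, ‖Y ω - X ω‖ ^ p ∂μ) ^ (1 / p) ≤ δ →
      |∫ ω, (f (Y ω) (κ ω) - f (X ω) (κ ω) - pathDeriv f (κ ω) (X ω) (Y ω - X ω)) ∂μ| ≤
        ε * (∫ ω, ‖Y ω - X ω‖ ^ p ∂μ) ^ (1 / p) := by
  have hp := hpq.lt
  have hp0 : 0 < p := by linarith
  have hp1 : 0 < p - 1 := by linarith
  have hq : 0 < q := hpq.symm.pos
  set A := C * (2 + 2 ^ (p - 1)) with hA
  have hA0 : 0 ≤ A := by positivity
  obtain ⟨R, hR, htail⟩ := exists_tail_le hpq hP A (ε := ε / 3) (by positivity)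
  obtain ⟨K, hK, htay⟩ := exists_taylor_bound hp hC1 hC hG (ε := ε / 3) (by positivity) hR
  rw [← hA] at htay
  rw [abs_of_nonneg hA0] at htail
  set g : Path T → ℝ := Set.indicator {x : Path T | R < ‖x‖}
    (fun x => A * (1 + ‖x‖ ^ (p - 1))) with hg
  have hg0 : ∀ x, 0 ≤ g x := fun x => Set.indicator_nonneg (fun x _ => by positivity) x
  have hS : MeasurableSet {x : Path T | R < ‖x‖} := measurableSet_lt measurable_const measurable_norm
  have hgm : Measurable g := Measurable.indicator (by fun_prop) hS
  have hgq : MemLp g (ENNReal.ofReal q) P :=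
    ((memLp_one_add_norm_rpow hpq hP).const_mul A).indicator hS
  -- the superlinear term `K L ^ p` is absorbed once `K L ^ (p - 1) ≤ ε / 3`
  obtain ⟨δ, hδ, hKδ⟩ : ∃ δ : ℝ, 0 < δ ∧ K * δ ^ (p - 1) ≤ ε / 3 := by
    have h1 : Tendsto (fun δ : ℝ => K * δ ^ (p - 1)) (𝓝 0) (𝓝 (K * 0 ^ (p - 1))) :=
      ((Real.continuousAt_rpow_const 0 (p - 1) (Or.inr hp1.le)).tendsto).const_mul K
    rw [Real.zero_rpow hp1.ne', mul_zero] at h1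
    have h2 : ∀ᶠ δ : ℝ in 𝓝[>] 0, K * δ ^ (p - 1) ≤ ε / 3 :=
      (h1.mono_left nhdsWithin_le_nhds).eventually (eventually_le_nhds (by positivity))
    obtain ⟨δ, h3, h4⟩ := (h2.and self_mem_nhdsWithin).exists
    exact ⟨δ, h4, h3⟩
  refine ⟨δ, hδ, fun {Ω} _ μ _ X Y κ hX hY hκ hXP hΔ hL => ?_⟩
  set L := (∫ ω, ‖Y ω - X ω‖ ^ p ∂μ) ^ (1 / p) with hLdef
  have hI0 : 0 ≤ ∫ ω, ‖Y ω - X ω‖ ^ p ∂μ := integral_nonneg fun ω => by positivity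
  have hL0 : 0 ≤ L := by positivity
  have hLp : L ^ p = ∫ ω, ‖Y ω - X ω‖ ^ p ∂μ := by
    rw [hLdef, ← Real.rpow_mul hI0, one_div_mul_cancel hp0.ne', Real.rpow_one]
  have hgX : MemLp (fun ω => g (X ω)) (ENNReal.ofReal q) μ := by
    rw [← hXP] at hgq
    exact (memLp_map_measure_iff hgm.aestronglyMeasurable hX.aemeasurable).1 hgq
  have hgXi : ∫ ω, g (X ω) ^ q ∂μ = ∫ x, g x ^ q ∂P := by
    rw [← hXP, integral_map hX.aemeasurable (hgm.pow_const q).aestronglyMeasurable]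
  have hH1 : ∫ ω, ‖Y ω - X ω‖ ∂μ ≤ L := by
    have h := integral_mul_le_Lp_mul_Lq_of_nonneg hpq (f := fun ω => ‖Y ω - X ω‖)
      (g := fun _ : Ω => (1 : ℝ)) (ae_of_all μ fun ω => norm_nonneg _)
      (ae_of_all μ fun ω => zero_le_one) hΔ.norm (memLp_const 1)
    simpa [hLdef] using h
  have hH2 : ∫ ω, ‖Y ω - X ω‖ * g (X ω) ∂μ ≤ L * (ε / 3) := by
    refine (integral_mul_le_Lp_mul_Lq_of_nonneg hpq (ae_of_all μ fun ω => norm_nonneg _)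
      (ae_of_all μ fun ω => hg0 _) hΔ.norm hgX).trans ?_
    rw [hgXi]
    exact mul_le_mul_of_nonneg_left htail hL0
  have hi1 : Integrable (fun ω => ‖Y ω - X ω‖) μ :=
    (hΔ.integrable (by rw [← ENNReal.ofReal_one]; exact ENNReal.ofReal_le_ofReal hp.le)).norm
  have hi2 := integrable_mul_of_holderConjugate hpq hΔ.norm hgX
  have hi3 := integrable_norm_rpow hp0 hΔ
  have hbound : ∀ ω, ‖f (Y ω) (κ ω) - f (X ω) (κ ω) - pathDeriv f (κ ω) (X ω) (Y ω - X ω)‖ ≤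
      ε / 3 * ‖Y ω - X ω‖ + K * ‖Y ω - X ω‖ ^ p + ‖Y ω - X ω‖ * g (X ω) := fun ω => by
    refine (htay (X ω) (Y ω) (κ ω)).trans (le_of_eq ?_)
    rw [← rpow_sub_one_mul_self hp (norm_nonneg (Y ω - X ω))]
    ring
  refine (norm_integral_le_of_norm_le (((hi1.const_mul _).add (hi3.const_mul _)).add hi2)
    (ae_of_all _ hbound)).trans ?_
  have e1 := integral_add ((hi1.const_mul (ε / 3)).add (hi3.const_mul K)) hi2
  have e2 := integral_add (hi1.const_mul (ε / 3)) (hi3.const_mul K)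
  simp only [Pi.add_apply] at e1 e2 ⊢
  rw [e1, e2, integral_const_mul, integral_const_mul, ← hLp]
  have h3 : K * L ^ p ≤ ε / 3 * L := by
    rw [← rpow_sub_one_mul_self hp hL0, ← mul_assoc]
    refine mul_le_mul_of_nonneg_right (le_trans ?_ hKδ) hL0
    gcongr
  have h4 : ε / 3 * ∫ ω, ‖Y ω - X ω‖ ∂μ ≤ ε / 3 * L := by gcongr
  linarith

end Remainder

/-! ### Stopping times and randomised stopping -/

section Stopping

variable {T : ℕ} {p q : ℝ} {f : Path T → Fin T → ℝ} {C : ℝ} {P Q : Measure (Path T)}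

lemma mem_stoppingTimes {τ : Path T → Fin T} :
    τ ∈ stoppingTimes T ↔ ∀ t, MeasurableSet[canonicalFiltration T t] {x | τ x ≤ t} := by
  simp [stoppingTimes, IsStoppingTime]

lemma measurableSet_eq_of_mem_stoppingTimes {τ : Path T → Fin T} (hτ : τ ∈ stoppingTimes T)
    (t : Fin T) : MeasurableSet[canonicalFiltration T t] {x | τ x = t} := by
  rw [mem_stoppingTimes] at hτ
  have h : {x | τ x = t} = {x | τ x ≤ t} \ ⋃ s : Set.Iio t, {x | τ x ≤ s} := by
    ext x
    simp only [Set.mem_ofPred_eq, Set.mem_sdiff, Set.mem_iUnion, Subtype.exists, Set.mem_Iio,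
      exists_prop, not_exists, not_and, not_le]
    exact ⟨fun h => ⟨h.le, fun s hs => h ▸ hs⟩, fun ⟨h1, h2⟩ =>
      le_antisymm h1 (le_of_not_gt fun h3 => lt_irrefl _ (h2 _ h3))⟩
  rw [h]
  exact (hτ t).diff (MeasurableSet.iUnion fun s =>
    (canonicalFiltration T).mono (le_of_lt s.2) _ (hτ s))

lemma measurable_of_mem_stoppingTimes {τ : Path T → Fin T} (hτ : τ ∈ stoppingTimes T) :
    Measurable τ :=
  measurable_to_countable' fun t =>
    (canonicalFiltration T).le t _ (measurableSet_eq_of_mem_stoppingTimes hτ t)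

lemma bddBelow_stopping (hp : 1 < p)
    (hC1 : ∀ t : Fin T, ContDiff ℝ 1 (fun x => f x t)) (hC : 0 ≤ C)
    (hG : ∀ k x, ‖pathDeriv f k x‖ ≤ C * (1 + ‖x‖ ^ (p - 1))) (hQ : Q ∈ finiteMomentLaws T p) :
    BddBelow (Set.range fun τ : stoppingTimes T => ∫ x, f x (τ.1 x) ∂Q) := by
  have := hQ.1
  obtain ⟨M, hM, hb⟩ := exists_abs_le hp hC1 hC hG
  refine ⟨-∫ x, M * (1 + ‖x‖ ^ p) ∂Q, ?_⟩
  rintro _ ⟨τ, rfl⟩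
  have h := norm_integral_le_of_norm_le (f := fun x => f x (τ.1 x))
    (((integrable_const (1 : ℝ)).add
    (integrable_norm_rpow (by linarith) hQ.2)).const_mul M) (ae_of_all _ fun x => hb x (τ.1 x))
  exact (abs_le.1 h).1

lemma stoppingValue_le (hp : 1 < p)
    (hC1 : ∀ t : Fin T, ContDiff ℝ 1 (fun x => f x t)) (hC : 0 ≤ C)
    (hG : ∀ k x, ‖pathDeriv f k x‖ ≤ C * (1 + ‖x‖ ^ (p - 1))) (hQ : Q ∈ finiteMomentLaws T p)
    {τ : Path T → Fin T} (hτ : τ ∈ stoppingTimes T) :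
    stoppingValue f Q ≤ ∫ x, f x (τ x) ∂Q :=
  ciInf_le (bddBelow_stopping hp hC1 hC hG hQ) (⟨τ, hτ⟩ : stoppingTimes T)

/-- The first time at which the cumulative weight `∑_{s ≤ t} a_s` reaches the level `u` (the last
time if the level is never reached). For a uniform `u`, this is the randomised stopping time that
stops at time `t` with probability `a_t`. -/
def levelTime [NeZero T] (a : Fin T → Path T → ℝ) (u : ℝ) (x : Path T) : Fin T :=
  (Finset.univ.filter fun t => u ≤ ∑ s ∈ Finset.Iic t, a s x).inf id

lemma levelTime_le_iff [NeZero T] {a : Fin T → Path T → ℝ} (ha0 : ∀ t x, 0 ≤ a t x) {u : ℝ}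
    {x : Path T} {t : Fin T} (ht : t < ⊤) :
    levelTime a u x ≤ t ↔ u ≤ ∑ s ∈ Finset.Iic t, a s x := by
  rw [levelTime, Finset.inf_le_iff ht]
  simp only [Finset.mem_filter, Finset.mem_univ, true_and, id]
  exact ⟨fun ⟨s, h1, h2⟩ => h1.trans (Finset.sum_le_sum_of_subset_of_nonneg
    (Finset.Iic_subset_Iic.2 h2) fun i _ _ => ha0 i x), fun h => ⟨t, h, le_rfl⟩⟩

lemma levelTime_mem [NeZero T] {a : Fin T → Path T → ℝ} (ha0 : ∀ t x, 0 ≤ a t x)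
    (ha : ∀ t, Measurable[canonicalFiltration T t] (a t)) (u : ℝ) :
    levelTime a u ∈ stoppingTimes T := by
  rw [mem_stoppingTimes]
  intro t
  rcases eq_or_lt_of_le (le_top : t ≤ ⊤) with rfl | ht
  · simp
  · simp only [levelTime_le_iff ha0 ht]
    refine @measurableSet_le _ _ _ _ _ (_) _ _ _ _ _ measurable_const
      (Finset.measurable_sum _ fun s hs => ?_)
    exact (ha s).mono ((canonicalFiltration T).mono (Finset.mem_Iic.1 hs)) le_rfl

lemma levelTime_eq_iff [NeZero T] {a : Fin T → Path T → ℝ} (ha0 : ∀ t x, 0 ≤ a t x) {u : ℝ}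
    {x : Path T} (hx : ∑ t, a t x = 1) (hu : u ∈ Set.Ioc (0 : ℝ) 1) {t : Fin T} :
    levelTime a u x = t ↔ u ∈ Set.Ioc (∑ s ∈ Finset.Iio t, a s x) (∑ s ∈ Finset.Iic t, a s x) := by
  have hle : ∀ t, levelTime a u x ≤ t ↔ u ≤ ∑ s ∈ Finset.Iic t, a s x := fun t => by
    rcases eq_or_lt_of_le (le_top : t ≤ ⊤) with rfl | ht
    · simp [hx, hu.2]
    · exact levelTime_le_iff ha0 ht
  have hlt : levelTime a u x < t ↔ u ≤ ∑ s ∈ Finset.Iio t, a s x := by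
    constructor
    · intro h
      refine ((hle _).1 le_rfl).trans (Finset.sum_le_sum_of_subset_of_nonneg ?_
        fun i _ _ => ha0 i x)
      intro s hs
      exact Finset.mem_Iio.2 ((Finset.mem_Iic.1 hs).trans_lt h)
    · intro h
      have hne : (Finset.Iio t).Nonempty := by
        rw [Finset.nonempty_iff_ne_empty]
        intro h0
        rw [h0, Finset.sum_empty] at h
        exact absurd hu.1 (not_lt.2 h)
      have hm := Finset.max'_mem _ hne
      refine lt_of_le_of_lt ((hle ((Finset.Iio t).max' hne)).2 (h.trans
        (Finset.sum_le_sum_of_subset_of_nonneg ?_ fun i _ _ => ha0 i x))) (Finset.mem_Iio.1 hm)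
      intro s hs
      exact Finset.mem_Iic.2 (Finset.le_max' _ _ hs)
  rw [Set.mem_Ioc, ← hle, ← not_le, ← hlt, not_lt]
  exact ⟨fun h => ⟨h.ge, h.le⟩, fun h => le_antisymm h.2 h.1⟩

/-- Randomisation does not lower the value: stopping at time `t` with an adapted probability `a_t`
costs at least `s(Q)`, because it is an average over levels `u ∈ (0, 1]` of genuine stopping
times. -/
theorem stoppingValue_le_sum_weights [NeZero T] [IsProbabilityMeasure Q]
    {a : Fin T → Path T → ℝ} (ha0 : ∀ t x, 0 ≤ a t x)
    (ha : ∀ t, Measurable[canonicalFiltration T t] (a t)) (ha1 : ∀ᵐ x ∂Q, ∑ t, a t x = 1)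
    (hfm : ∀ t, Measurable fun x => f x t) (hfi : ∀ t, Integrable (fun x => f x t) Q)
    (hbdd : BddBelow (Set.range fun τ : stoppingTimes T => ∫ x, f x (τ.1 x) ∂Q)) :
    stoppingValue f Q ≤ ∑ t, ∫ x, f x t * a t x ∂Q := by
  have ham : ∀ t, Measurable (a t) := fun t => (ha t).mono ((canonicalFiltration T).le t) le_rfl
  set A : Fin T → Path T → ℝ := fun t x => ∑ s ∈ Finset.Iic t, a s x with hA
  set B : Fin T → Path T → ℝ := fun t x => ∑ s ∈ Finset.Iio t, a s x with hB
  have hAm : ∀ t, Measurable (A t) := fun t => Finset.measurable_sum _ fun s _ => ham s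
  have hBm : ∀ t, Measurable (B t) := fun t => Finset.measurable_sum _ fun s _ => ham s
  have hAB : ∀ t x, A t x - B t x = a t x := fun t x => by
    simp only [hA, hB]
    rw [← Finset.Iio_insert, Finset.sum_insert (by simp)]
    ring
  set ν : Measure ℝ := volume.restrict (Set.Ioc 0 1) with hν
  have : IsProbabilityMeasure ν := ⟨by simp [hν]⟩
  set S : Fin T → Set (ℝ × Path T) := fun t => {z | B t z.2 < z.1 ∧ z.1 ≤ A t z.2} with hS
  have hSm : ∀ t, MeasurableSet (S t) := fun t =>
    (measurableSet_lt ((hBm t).comp measurable_snd) measurable_fst).inter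
      (measurableSet_le measurable_fst ((hAm t).comp measurable_snd))
  set G : Fin T → ℝ × Path T → ℝ := fun t z => f z.2 t * (S t).indicator 1 z with hGdef
  have hGi : ∀ t, Integrable (G t) (ν.prod Q) := fun t => by
    refine Integrable.mono ((hfi t).comp_snd ν) ?_ (ae_of_all _ fun z => ?_)
    · exact (((hfm t).comp measurable_snd).mul
        (measurable_one.indicator (hSm t))).aestronglyMeasurable
    · simp only [hGdef, norm_mul]
      refine mul_le_of_le_one_right (norm_nonneg _) ?_
      rw [Set.indicator_apply]
      split_ifs <;> simp
  -- the weight `a t x` is the length of the interval of levels whose level time is `t`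
  have hinner : ∀ t, ∫ u, ∫ x, G t (u, x) ∂Q ∂ν = ∫ x, f x t * a t x ∂Q := fun t => by
    rw [integral_integral_swap (f := fun u x => G t (u, x)) (hGi t)]
    refine integral_congr_ae ?_
    filter_upwards [ha1] with x hx
    simp only [hGdef]
    rw [integral_const_mul]
    congr 1
    have h1 : (fun u : ℝ => (S t).indicator (1 : ℝ × Path T → ℝ) (u, x)) =
        (Set.Ioc (B t x) (A t x)).indicator 1 := rfl
    have hB0 : 0 ≤ B t x := Finset.sum_nonneg fun s _ => ha0 s x
    have hA1 : A t x ≤ 1 := by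
      rw [← hx]
      exact Finset.sum_le_sum_of_subset_of_nonneg (Finset.subset_univ _) fun i _ _ => ha0 i x
    have hsub : Set.Ioc (B t x) (A t x) ⊆ Set.Ioc 0 1 := Set.Ioc_subset_Ioc hB0 hA1
    rw [h1, integral_indicator_one measurableSet_Ioc, measureReal_def, hν,
      Measure.restrict_apply measurableSet_Ioc, Set.inter_eq_left.2 hsub, Real.volume_Ioc, hAB,
      ENNReal.toReal_ofReal (ha0 t x)]
  have hlevel : ∀ u ∈ Set.Ioc (0 : ℝ) 1, stoppingValue f Q ≤ ∫ x, ∑ t, G t (u, x) ∂Q := by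
    intro u hu
    refine (ciInf_le hbdd (⟨levelTime a u, levelTime_mem ha0 ha u⟩ : stoppingTimes T)).trans
      (le_of_eq (integral_congr_ae ?_))
    filter_upwards [ha1] with x hx
    have h1 : ∀ t, G t (u, x) = if levelTime a u x = t then f x t else 0 := fun t => by
      simp only [hGdef, Set.indicator_apply, levelTime_eq_iff ha0 hx hu (t := t)]
      split_ifs with h h' h'
      · simp
      · exact absurd h h'
      · exact absurd h' h
      · simp
    simp [h1]
  have hsum : Integrable (fun z => ∑ t, G t z) (ν.prod Q) := integrable_finsetSum _ fun t _ => hGi t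
  calc stoppingValue f Q = ∫ _u, stoppingValue f Q ∂ν := by simp
    _ ≤ ∫ u, ∫ x, ∑ t, G t (u, x) ∂Q ∂ν := by
        refine integral_mono_ae (integrable_const _) hsum.integral_prod_left ?_
        filter_upwards [ae_restrict_mem measurableSet_Ioc] with u hu using hlevel u hu
    _ = ∫ z, ∑ t, G t z ∂(ν.prod Q) := (integral_prod _ hsum).symm
    _ = ∑ t, ∫ z, G t z ∂(ν.prod Q) := integral_finsetSum _ fun t _ => hGi t
    _ = _ := by
        refine Finset.sum_congr rfl fun t _ => ?_
        rw [integral_prod _ (hGi t), hinner]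

end Stopping

/-! ### Consequences of causality -/

section Causality

variable {T : ℕ} {p q : ℝ} {f : Path T → Fin T → ℝ} {C : ℝ} {P Q : Measure (Path T)}

/-- Under a causal law `ρ` of `(X, Y)`, an event of the past of `Y` up to time `t` has a conditional
probability given `X` that is a function of the past of `X` up to time `t`. -/
lemma IsCausal.exists_condExp_eq {ρ : Measure (Path T × Path T)} [IsProbabilityMeasure ρ]
    (hρ : IsCausal ρ) {t : Fin T} {S : Set (Path T)}
    (hS : MeasurableSet[canonicalFiltration T t] S) :
    ∃ h : Path T → ℝ, Measurable[canonicalFiltration T t] h ∧ (∀ x, 0 ≤ h x) ∧ (∀ x, h x ≤ 1) ∧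
      ρ[(Prod.snd ⁻¹' S).indicator (fun _ => (1 : ℝ)) | MeasurableSpace.comap Prod.fst
        (inferInstance : MeasurableSpace (Path T))] =ᵐ[ρ] fun z => h z.1 := by
  obtain ⟨A, hA, rfl⟩ := hS
  have hle : MeasurableSpace.comap (Prod.fst : Path T × Path T → Path T)
      (canonicalFiltration T t) ≤ (inferInstance : MeasurableSpace (Path T × Path T)) :=
    (MeasurableSpace.comap_mono ((canonicalFiltration T).le t)).trans measurable_fst.comap_le
  have hE : MeasurableSet (Prod.snd ⁻¹' (Preorder.restrictLe t ⁻¹' A) :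
      Set (Path T × Path T)) :=
    measurable_snd ((Preorder.measurable_restrictLe t) hA)
  set I : Path T × Path T → ℝ :=
    (Prod.snd ⁻¹' (Preorder.restrictLe t ⁻¹' A)).indicator (fun _ => (1 : ℝ)) with hI
  have hIi : Integrable I ρ := (integrable_const _).indicator hE
  have hc : ρ[I | MeasurableSpace.comap Prod.fst (inferInstance : MeasurableSpace (Path T))]
      =ᵐ[ρ] ρ[I | MeasurableSpace.comap Prod.fst (canonicalFiltration T t)] := hρ t A hA
  obtain ⟨h, hm, hh⟩ := (stronglyMeasurable_condExp (f := I) (μ := ρ)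
    (m := MeasurableSpace.comap Prod.fst (canonicalFiltration T t))).measurable
    |>.exists_eq_measurable_comp (mY := canonicalFiltration T t)
  have h0 : 0 ≤ᵐ[ρ] ρ[I | MeasurableSpace.comap Prod.fst (canonicalFiltration T t)] :=
    condExp_nonneg (ae_of_all _ fun z => Set.indicator_nonneg (fun _ _ => zero_le_one) z)
  have h1 : ρ[I | MeasurableSpace.comap Prod.fst (canonicalFiltration T t)] ≤ᵐ[ρ]
      fun _ => (1 : ℝ) := by
    rw [← condExp_const (μ := ρ) hle (1 : ℝ)]
    exact condExp_mono hIi (integrable_const _)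
      (ae_of_all _ fun z => Set.indicator_le_self' (fun _ _ => zero_le_one) z)
  refine ⟨fun x => min (max (h x) 0) 1, (hm.max measurable_const).min measurable_const,
    fun x => le_min (le_max_right _ _) zero_le_one, fun x => min_le_right _ _, ?_⟩
  filter_upwards [hc, h0, h1] with z hz hz0 hz1
  refine hz.trans ?_
  rw [hh] at hz0 hz1 ⊢
  simp only [Function.comp_apply, Pi.zero_apply] at hz0 hz1 ⊢
  rw [max_eq_left hz0, min_eq_left hz1]

/-- If the law of `(Y, X)` is causal, then `τ(X)` is a randomised stopping time for `Y`. -/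
theorem stoppingValue_le_of_isCausal (hp : 1 < p)
    (hC1 : ∀ t : Fin T, ContDiff ℝ 1 (fun x => f x t)) (hC : 0 ≤ C)
    (hG : ∀ k x, ‖pathDeriv f k x‖ ≤ C * (1 + ‖x‖ ^ (p - 1))) (hQ : Q ∈ finiteMomentLaws T p)
    {ρ : Measure (Path T × Path T)} [IsProbabilityMeasure ρ] (hρ : IsCausal ρ)
    (hρQ : ρ.map Prod.fst = Q) {τ : Path T → Fin T} (hτ : τ ∈ stoppingTimes T) :
    stoppingValue f Q ≤ ∫ z, f z.1 (τ z.2) ∂ρ := by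
  have hQp := hQ.1
  have : NeZero T := ⟨fun h => by subst h; exact (τ 0).elim0⟩
  have hτm := measurable_of_mem_stoppingTimes hτ
  have hle : MeasurableSpace.comap (Prod.fst : Path T × Path T → Path T)
      (inferInstance : MeasurableSpace (Path T)) ≤
      (inferInstance : MeasurableSpace (Path T × Path T)) := measurable_fst.comap_le
  choose a ham ha0 ha1 hae using fun t : Fin T =>
    hρ.exists_condExp_eq (measurableSet_eq_of_mem_stoppingTimes hτ t)
  have ham' : ∀ t, Measurable (a t) := fun t => (ham t).mono ((canonicalFiltration T).le t) le_rfl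
  set I : Fin T → Path T × Path T → ℝ := fun t =>
    (Prod.snd ⁻¹' {x | τ x = t}).indicator (fun _ => (1 : ℝ)) with hI
  have hIm : ∀ t, Measurable (I t) := fun t =>
    measurable_const.indicator (measurable_snd (hτm (measurableSet_singleton t)))
  have hIi : ∀ t, Integrable (I t) ρ := fun t => (integrable_const _).indicator
    (measurable_snd (hτm (measurableSet_singleton t)))
  have hIeq : ∀ t z, I t z = if τ z.2 = t then 1 else 0 := fun t z => by
    simp [hI, Set.indicator_apply]
  have hsum1 : ∀ᵐ x ∂Q, ∑ t, a t x = 1 := by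
    rw [← hρQ, ae_map_iff measurable_fst.aemeasurable (measurableSet_eq_fun
      (Finset.measurable_sum _ fun t _ => ham' t) measurable_const)]
    have h1 : ρ[∑ t, I t | MeasurableSpace.comap Prod.fst
        (inferInstance : MeasurableSpace (Path T))] = fun _ => (1 : ℝ) := by
      rw [← condExp_const (μ := ρ) hle (1 : ℝ)]
      congr 1
      ext z
      simp [hIeq]
    have h2 := condExp_finsetSum (μ := ρ) (s := Finset.univ) (f := I) (fun t _ => hIi t)
      (MeasurableSpace.comap Prod.fst (inferInstance : MeasurableSpace (Path T)))
    filter_upwards [h2, ae_all_iff.2 hae] with z hz hz2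
    rw [h1, Finset.sum_apply] at hz
    refine Eq.trans ?_ hz.symm
    exact Finset.sum_congr rfl fun t _ => (hz2 t).symm
  have hfi : ∀ t, Integrable (fun x => f x t) Q := fun t =>
    integrable_payoff hp hC1 hC hG measurable_id hQ.2 (κ := fun _ => t) measurable_const
  have hfm : ∀ t, Measurable fun x => f x t := fun t => (hC1 t).continuous.measurable
  have hfiρ : ∀ t, Integrable (fun z : Path T × Path T => f z.1 t) ρ := fun t => by
    have := hfi t
    rw [← hρQ] at this
    exact this.comp_measurable measurable_fst
  have hfIi : ∀ t, Integrable ((fun z : Path T × Path T => f z.1 t) * I t) ρ := fun t =>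
    Integrable.mono (hfiρ t) (((hfm t).comp measurable_fst).mul (hIm t)).aestronglyMeasurable
      (ae_of_all _ fun z => by
        rw [Pi.mul_apply, norm_mul, hIeq]
        refine mul_le_of_le_one_right (norm_nonneg _) ?_
        split_ifs <;> simp)
  refine (stoppingValue_le_sum_weights ha0 ham hsum1 hfm hfi
    (bddBelow_stopping hp hC1 hC hG hQ)).trans (le_of_eq ?_)
  have hterm : ∀ t, ∫ x, f x t * a t x ∂Q = ∫ z, f z.1 t * I t z ∂ρ := fun t => by
    have hm : AEStronglyMeasurable (fun x => f x t * a t x) (ρ.map Prod.fst) :=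
      ((hfm t).mul (ham' t)).aestronglyMeasurable
    rw [← hρQ, integral_map measurable_fst.aemeasurable hm]
    have hpull := condExp_mul_of_stronglyMeasurable_left (μ := ρ)
      (m := MeasurableSpace.comap Prod.fst (inferInstance : MeasurableSpace (Path T)))
      (f := fun z : Path T × Path T => f z.1 t) (g := I t)
      ((hfm t).comp (comap_measurable Prod.fst)).stronglyMeasurable (hfIi t) (hIi t)
    have h3 := integral_condExp (μ := ρ) hle (f := (fun z : Path T × Path T => f z.1 t) * I t)
    rw [integral_congr_ae hpull] at h3
    rw [show ∫ z, f z.1 t * I t z ∂ρ = ∫ z, ((fun z : Path T × Path T => f z.1 t) * I t) z ∂ρ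
      from rfl, ← h3]
    refine integral_congr_ae ?_
    filter_upwards [hae t] with z hz
    rw [Pi.mul_apply, ← hz]
  rw [Finset.sum_congr rfl fun t _ => hterm t]
  refine (integral_finsetSum _ fun t _ => hfIi t).symm.trans ?_
  refine integral_congr_ae (ae_of_all _ fun z => ?_)
  simp [hIeq]

/-- Under a causal law of `(X, Y)`, replacing `g(X)` by its projection `E[g(X) | X_1, …, X_t]` does
not change its correlation with a functional of the past of `X` plus one of the past of `Y`. -/
theorem IsCausal.integral_mul_sub_eq (hpq : p.HolderConjugate q) [IsProbabilityMeasure P]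
    {π : Measure (Path T × Path T)} [IsProbabilityMeasure π] (hπ : IsCausal π)
    (hπP : π.map Prod.fst = P) {g : Path T → ℝ} (hgm : Measurable g)
    (hg : MemLp g (ENNReal.ofReal q) P) (t : Fin T)
    (hX : MemLp (fun z : Path T × Path T => z.1 t) (ENNReal.ofReal p) π)
    (hY : MemLp (fun z : Path T × Path T => z.2 t) (ENNReal.ofReal p) π) :
    ∫ z, g z.1 * (z.2 t - z.1 t) ∂π =
      ∫ z, (P[g | canonicalFiltration T t]) z.1 * (z.2 t - z.1 t) ∂π := by
  have hFle := (canonicalFiltration T).le t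
  have hq1 : 1 ≤ ENNReal.ofReal q := by
    rw [← ENNReal.ofReal_one]; exact ENNReal.ofReal_le_ofReal hpq.symm.lt.le
  set ĝ := P[g | canonicalFiltration T t] with hĝ
  have hĝsm : StronglyMeasurable[canonicalFiltration T t] ĝ := stronglyMeasurable_condExp
  have hĝm : Measurable ĝ := (hĝsm.mono hFle).measurable
  have hgi : Integrable g P := hg.integrable hq1
  have hĝq : MemLp ĝ (ENNReal.ofReal q) P := hg.condExp hq1
  -- the projection error
  set d : Path T → ℝ := g - ĝ with hd
  have hdm : Measurable d := hgm.sub hĝm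
  have hdq : MemLp d (ENNReal.ofReal q) P := hg.sub hĝq
  have hdi : Integrable d P := hdq.integrable hq1
  have hdc : P[d | canonicalFiltration T t] =ᵐ[P] 0 := by
    refine (condExp_sub hgi (hĝq.integrable hq1) _).trans ?_
    rw [condExp_of_stronglyMeasurable hFle hĝsm (hĝq.integrable hq1)]
    simp [hĝ]
  have horth : ∀ k : Path T → ℝ, Measurable[canonicalFiltration T t] k →
      Integrable (fun x => k x * d x) P → ∫ x, k x * d x ∂P = 0 := fun k hk hkd => by
    have h1 := condExp_mul_of_stronglyMeasurable_left (μ := P) hk.stronglyMeasurable hkd hdi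
    have h2 := integral_condExp (μ := P) hFle (f := k * d)
    rw [integral_congr_ae h1] at h2
    rw [show ∫ x, k x * d x ∂P = ∫ x, (k * d) x ∂P from rfl, ← h2]
    refine integral_eq_zero_of_ae ?_
    filter_upwards [hdc] with x hx
    simp [hx]
  have hdXq : MemLp (fun z : Path T × Path T => d z.1) (ENNReal.ofReal q) π := by
    rw [← hπP] at hdq
    exact (memLp_map_measure_iff hdm.aestronglyMeasurable measurable_fst.aemeasurable).1 hdq
  have hdXi : Integrable (fun z : Path T × Path T => d z.1) π := hdXq.integrable hq1
  have hdX : Integrable (fun z : Path T × Path T => z.1 t * d z.1) π :=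
    integrable_mul_of_holderConjugate hpq hX hdXq
  have hdY : Integrable (fun z : Path T × Path T => z.2 t * d z.1) π :=
    integrable_mul_of_holderConjugate hpq hY hdXq
  have ht : Measurable[canonicalFiltration T t] fun x : Path T => x t :=
    (measurable_pi_apply (⟨t, Set.mem_Iic.2 le_rfl⟩ : Set.Iic t)).comp (comap_measurable (Preorder.restrictLe t))
  have hXzero : ∫ z, z.1 t * d z.1 ∂π = 0 := by
    have hm : AEStronglyMeasurable (fun x : Path T => x t * d x) (π.map Prod.fst) :=
      ((measurable_pi_apply t).mul hdm).aestronglyMeasurable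
    have := integral_map measurable_fst.aemeasurable hm
    rw [← this, hπP]
    refine horth _ ht ?_
    rw [← hπP]
    exact (integrable_map_measure hm measurable_fst.aemeasurable).2 hdX
  -- given the past of `Y` up to time `t`, the projection error has conditional mean zero
  have hYle : MeasurableSpace.comap (Prod.snd : Path T × Path T → Path T)
      (canonicalFiltration T t) ≤ (inferInstance : MeasurableSpace (Path T × Path T)) :=
    (MeasurableSpace.comap_mono hFle).trans measurable_snd.comap_le
  have hle : MeasurableSpace.comap (Prod.fst : Path T × Path T → Path T)
      (inferInstance : MeasurableSpace (Path T)) ≤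
      (inferInstance : MeasurableSpace (Path T × Path T)) := measurable_fst.comap_le
  have hYc : π[fun z => d z.1 | MeasurableSpace.comap Prod.snd (canonicalFiltration T t)]
      =ᵐ[π] 0 := by
    refine (ae_eq_condExp_of_forall_setIntegral_eq hYle hdXi
      (fun s _ _ => integrableOn_zero) ?_ stronglyMeasurable_zero.aestronglyMeasurable).symm
    rintro _ ⟨S, hS, rfl⟩ -
    obtain ⟨h, hhm, hh0, hh1, hae⟩ := hπ.exists_condExp_eq hS
    have hSm : MeasurableSet (Prod.snd ⁻¹' S : Set (Path T × Path T)) :=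
      measurable_snd (hFle _ hS)
    set I : Path T × Path T → ℝ := (Prod.snd ⁻¹' S).indicator (fun _ => (1 : ℝ)) with hI
    have hdI : (fun z : Path T × Path T => d z.1) * I =
        (Prod.snd ⁻¹' S).indicator fun z => d z.1 := by
      ext z
      by_cases hz : z ∈ Prod.snd ⁻¹' S <;> simp [hI, hz]
    have hpull := condExp_mul_of_stronglyMeasurable_left (μ := π)
      (m := MeasurableSpace.comap Prod.fst (inferInstance : MeasurableSpace (Path T)))
      (f := fun z : Path T × Path T => d z.1) (g := I)
      (hdm.comp (comap_measurable Prod.fst)).stronglyMeasurable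
      (by rw [hdI]; exact hdXi.indicator hSm) ((integrable_const _).indicator hSm)
    have h3 := integral_condExp (μ := π) hle (f := (fun z : Path T × Path T => d z.1) * I)
    rw [integral_congr_ae hpull, hdI, integral_indicator hSm] at h3
    rw [← h3]
    have hhm' : Measurable h := hhm.mono hFle le_rfl
    have h4 : ∫ z, ((fun z : Path T × Path T => d z.1) * π[I | MeasurableSpace.comap Prod.fst
        (inferInstance : MeasurableSpace (Path T))]) z ∂π = ∫ z, h z.1 * d z.1 ∂π := by
      refine integral_congr_ae ?_
      filter_upwards [hae] with z hz
      rw [Pi.mul_apply, hz, mul_comm]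
    rw [h4, show ∫ z, h z.1 * d z.1 ∂π = ∫ x, h x * d x ∂(π.map Prod.fst) from
      (integral_map measurable_fst.aemeasurable (hhm'.mul hdm).aestronglyMeasurable).symm, hπP,
      horth h hhm]
    · simp
    · refine Integrable.mono hdi (hhm'.mul hdm).aestronglyMeasurable (ae_of_all _ fun x => ?_)
      rw [norm_mul, Real.norm_of_nonneg (hh0 x)]
      exact mul_le_of_le_one_left (norm_nonneg _) (hh1 x)
  have hYzero : ∫ z, z.2 t * d z.1 ∂π = 0 := by
    have h1 := condExp_mul_of_stronglyMeasurable_left (μ := π)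
      (m := MeasurableSpace.comap Prod.snd (canonicalFiltration T t))
      (f := fun z : Path T × Path T => z.2 t) (g := fun z => d z.1)
      (ht.comp (comap_measurable Prod.snd)).stronglyMeasurable hdY hdXi
    have h2 := integral_condExp (μ := π) hYle
      (f := (fun z : Path T × Path T => z.2 t) * fun z => d z.1)
    rw [integral_congr_ae h1] at h2
    rw [show ∫ z : Path T × Path T, z.2 t * d z.1 ∂π = ∫ z, ((fun z : Path T × Path T => z.2 t) *
      fun z : Path T × Path T => d z.1) z ∂π from rfl, ← h2]
    refine integral_eq_zero_of_ae ?_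
    filter_upwards [hYc] with z hz
    simp [hz]
  have hgX : MemLp (fun z : Path T × Path T => g z.1) (ENNReal.ofReal q) π := by
    rw [← hπP] at hg
    exact (memLp_map_measure_iff hgm.aestronglyMeasurable measurable_fst.aemeasurable).1 hg
  have hĝX : MemLp (fun z : Path T × Path T => ĝ z.1) (ENNReal.ofReal q) π := by
    rw [← hπP] at hĝq
    exact (memLp_map_measure_iff hĝm.aestronglyMeasurable measurable_fst.aemeasurable).1 hĝq
  have hYX : MemLp (fun z : Path T × Path T => z.2 t - z.1 t) (ENNReal.ofReal p) π := hY.sub hX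
  rw [← sub_eq_zero, ← integral_sub (integrable_mul_of_holderConjugate hpq.symm hgX hYX)
    (integrable_mul_of_holderConjugate hpq.symm hĝX hYX)]
  have h5 : ∀ z : Path T × Path T, g z.1 * (z.2 t - z.1 t) - ĝ z.1 * (z.2 t - z.1 t) =
      z.2 t * d z.1 - z.1 t * d z.1 := fun z => by
    simp only [hd, Pi.sub_apply]; ring
  simp only [h5]
  rw [integral_sub hdY hdX, hXzero, hYzero, sub_zero]

end Causality

/-! ### The upper bound -/

section Displacement

variable {T : ℕ} {p q : ℝ} {Ω : Type*} [MeasurableSpace Ω] {μ : Measure Ω}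

/-- The size `(∑_t E|Δ_t|^p)^{1/p}` of a random displacement `Δ`. -/
def displacementNorm (p : ℝ) (μ : Measure Ω) (Δ : Ω → Path T) : ℝ :=
  (∑ t, ∫ ω, |Δ ω t| ^ p ∂μ) ^ (1 / p)

lemma sum_integral_nonneg {Δ : Ω → Path T} : 0 ≤ ∑ t, ∫ ω, |Δ ω t| ^ p ∂μ :=
  Finset.sum_nonneg fun t _ => integral_nonneg fun ω => by positivity

lemma displacementNorm_nonneg {Δ : Ω → Path T} : 0 ≤ displacementNorm p μ Δ :=
  Real.rpow_nonneg sum_integral_nonneg _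

lemma displacementNorm_rpow (hp : 0 < p) {Δ : Ω → Path T} :
    displacementNorm p μ Δ ^ p = ∑ t, ∫ ω, |Δ ω t| ^ p ∂μ := by
  rw [displacementNorm, ← Real.rpow_mul sum_integral_nonneg, one_div_mul_cancel hp.ne',
    Real.rpow_one]

lemma integrable_abs_rpow (hp : 0 < p) {Δ : Ω → Path T} (hΔ : MemLp Δ (ENNReal.ofReal p) μ)
    (t : Fin T) : Integrable (fun ω => |Δ ω t| ^ p) μ :=
  integrable_norm_rpow hp (memLp_pi_iff.1 hΔ t)

/-- The supremum norm of the displacement is dominated by `displacementNorm`. -/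
lemma integral_norm_rpow_le (hp : 0 < p) {Δ : Ω → Path T}
    (hΔ : MemLp Δ (ENNReal.ofReal p) μ) :
    ∫ ω, ‖Δ ω‖ ^ p ∂μ ≤ displacementNorm p μ Δ ^ p := by
  rw [displacementNorm_rpow hp, ← integral_finsetSum _ fun t _ => integrable_abs_rpow hp hΔ t]
  refine integral_mono (integrable_norm_rpow hp hΔ)
    (integrable_finsetSum _ fun t _ => integrable_abs_rpow hp hΔ t) fun ω => ?_
  rcases isEmpty_or_nonempty (Fin T) with hT | hT
  · simp [Subsingleton.elim (Δ ω) 0, Real.zero_rpow hp.ne']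
  · obtain ⟨t, ht⟩ := Finite.exists_max fun t => ‖Δ ω t‖
    have h1 : ‖Δ ω‖ ≤ ‖Δ ω t‖ := (pi_norm_le_iff_of_nonneg (norm_nonneg _)).2 ht
    calc ‖Δ ω‖ ^ p ≤ |Δ ω t| ^ p := Real.rpow_le_rpow (norm_nonneg _) h1 hp.le
      _ ≤ ∑ t, |Δ ω t| ^ p := Finset.single_le_sum (f := fun t => |Δ ω t| ^ p)
          (fun _ _ => by positivity) (Finset.mem_univ t)

lemma integral_norm_rpow_rpow_le (hp : 0 < p) {Δ : Ω → Path T}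
    (hΔ : MemLp Δ (ENNReal.ofReal p) μ) :
    (∫ ω, ‖Δ ω‖ ^ p ∂μ) ^ (1 / p) ≤ displacementNorm p μ Δ := by
  calc (∫ ω, ‖Δ ω‖ ^ p ∂μ) ^ (1 / p) ≤ (displacementNorm p μ Δ ^ p) ^ (1 / p) :=
        Real.rpow_le_rpow (integral_nonneg fun ω => by positivity)
          (integral_norm_rpow_le hp hΔ) (by positivity)
    _ = displacementNorm p μ Δ := by
        rw [← Real.rpow_mul displacementNorm_nonneg, mul_one_div_cancel hp.ne', Real.rpow_one]

/-- Hölder's inequality over `Ω × {1, …, T}`. -/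
lemma sum_integral_mul_le (hpq : p.HolderConjugate q) {Δ g : Ω → Path T}
    (hΔ : MemLp Δ (ENNReal.ofReal p) μ) (hg : MemLp g (ENNReal.ofReal q) μ) :
    ∑ t, ∫ ω, g ω t * Δ ω t ∂μ ≤ displacementNorm q μ g * displacementNorm p μ Δ := by
  have hterm : ∀ t, ∫ ω, g ω t * Δ ω t ∂μ ≤
      (∫ ω, |g ω t| ^ q ∂μ) ^ (1 / q) * (∫ ω, |Δ ω t| ^ p ∂μ) ^ (1 / p) := fun t => by
    have hgt := memLp_pi_iff.1 hg t
    have hΔt := memLp_pi_iff.1 hΔ t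
    refine (integral_mono (integrable_mul_of_holderConjugate hpq.symm hgt hΔt)
      (integrable_mul_of_holderConjugate hpq.symm hgt.norm hΔt.norm) fun ω => ?_).trans
      (integral_mul_le_Lp_mul_Lq_of_nonneg hpq.symm (ae_of_all _ fun ω => norm_nonneg _)
        (ae_of_all _ fun ω => norm_nonneg _) hgt.norm hΔt.norm)
    exact (le_abs_self _).trans (abs_mul _ _).le
  refine (Finset.sum_le_sum fun t _ => hterm t).trans
    ((Real.inner_le_Lp_mul_Lq Finset.univ _ _ hpq.symm).trans (le_of_eq ?_))
  have h : ∀ {s : ℝ}, 0 < s → ∀ {h : Ω → Path T} (t : Fin T),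
      |(∫ ω, |h ω t| ^ s ∂μ) ^ (1 / s)| ^ s = ∫ ω, |h ω t| ^ s ∂μ := fun {s} hs {h} t => by
    have h0 : 0 ≤ ∫ ω, |h ω t| ^ s ∂μ := integral_nonneg fun ω => by positivity
    rw [abs_of_nonneg (by positivity), ← Real.rpow_mul h0, one_div_mul_cancel hs.ne',
      Real.rpow_one]
  simp only [h hpq.pos, h hpq.symm.pos, displacementNorm]

end Displacement

section UpperBound

variable {T : ℕ} {p q : ℝ} {f : Path T → Fin T → ℝ} {C : ℝ} {P Q : Measure (Path T)}

lemma memLp_partialDeriv [IsFiniteMeasure P] (hpq : p.HolderConjugate q)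
    (hC1 : ∀ t : Fin T, ContDiff ℝ 1 (fun x => f x t))
    (hG : ∀ k x, ‖pathDeriv f k x‖ ≤ C * (1 + ‖x‖ ^ (p - 1)))
    (hP : MemLp (fun x : Path T => x) (ENNReal.ofReal p) P)
    {τ : Path T → Fin T} (hτ : Measurable τ) (t : Fin T) :
    Measurable (fun x => partialDeriv f t x (τ x)) ∧
      MemLp (fun x => partialDeriv f t x (τ x)) (ENNReal.ofReal q) P := by
  have hm : Measurable (fun x => partialDeriv f t x (τ x)) := by
    simp only [partialDeriv_eq hC1]
    exact measurable_pathDeriv_apply hC1 measurable_id measurable_const hτ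
  refine ⟨hm, ((memLp_one_add_norm_rpow hpq hP).const_mul C).mono' hm.aestronglyMeasurable
    (ae_of_all _ fun x => ?_)⟩
  rw [partialDeriv_eq hC1]
  refine ((pathDeriv f (τ x) x).le_opNorm _).trans ?_
  have h1 : ‖(Pi.single t 1 : Path T)‖ = 1 := by rw [Pi.norm_single, norm_one]
  rw [h1, mul_one]
  exact hG _ _

lemma memLp_projectedDeriv [IsProbabilityMeasure P] (hpq : p.HolderConjugate q)
    (hC1 : ∀ t : Fin T, ContDiff ℝ 1 (fun x => f x t))
    (hG : ∀ k x, ‖pathDeriv f k x‖ ≤ C * (1 + ‖x‖ ^ (p - 1)))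
    (hP : MemLp (fun x : Path T => x) (ENNReal.ofReal p) P)
    {τ : Path T → Fin T} (hτ : Measurable τ) (t : Fin T) :
    MemLp (projectedDeriv f P τ t) (ENNReal.ofReal q) P :=
  (memLp_partialDeriv hpq hC1 hG hP hτ t).2.condExp
    (by rw [← ENNReal.ofReal_one]; exact ENNReal.ofReal_le_ofReal hpq.symm.lt.le)

/-- The first-order coefficient `(∑_t E|E[∂_t f(X, τ) | F_t]|^q)^{1/q}`. -/
def sensitivity (q : ℝ) (f : Path T → Fin T → ℝ) (P : Measure (Path T)) (τ : Path T → Fin T) :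
    ℝ :=
  displacementNorm q P fun x t => projectedDeriv f P τ t x

lemma IsCoupling.isProbabilityMeasure [IsProbabilityMeasure P]
    {π : Measure (Path T × Path T)} (hπ : IsCoupling P Q π) : IsProbabilityMeasure π := by
  have h : IsProbabilityMeasure (π.map Prod.fst) := by rwa [hπ.1]
  exact ⟨by rw [← h.measure_univ, Measure.map_apply measurable_fst MeasurableSet.univ,
    Set.preimage_univ]⟩

lemma IsCoupling.memLp {π : Measure (Path T × Path T)} (hπ : IsCoupling P Q π)
    (hP : P ∈ finiteMomentLaws T p) (hQ : Q ∈ finiteMomentLaws T p) :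
    MemLp (fun z : Path T × Path T => z.1) (ENNReal.ofReal p) π ∧
      MemLp (fun z : Path T × Path T => z.2) (ENNReal.ofReal p) π := by
  have h1 := hP.2
  have h2 := hQ.2
  rw [← hπ.1] at h1
  rw [← hπ.2] at h2
  exact ⟨(memLp_map_measure_iff measurable_id.aestronglyMeasurable
      measurable_fst.aemeasurable).1 h1,
    (memLp_map_measure_iff measurable_id.aestronglyMeasurable measurable_snd.aemeasurable).1 h2⟩

lemma transportCost_eq (hp : 0 < p) {π : Measure (Path T × Path T)}
    (h : MemLp (fun z : Path T × Path T => z.2 - z.1) (ENNReal.ofReal p) π) :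
    transportCost p π = ENNReal.ofReal (displacementNorm p π fun z => z.2 - z.1) := by
  rw [transportCost, displacementNorm, ← ENNReal.ofReal_rpow_of_nonneg sum_integral_nonneg
    (by positivity), ENNReal.ofReal_sum_of_nonneg
    fun t _ => integral_nonneg fun ω => by positivity]
  congr 1
  refine Finset.sum_congr rfl fun t _ => ?_
  rw [ofReal_integral_eq_lintegral_ofReal (integrable_abs_rpow hp h t)
    (ae_of_all _ fun ω => by positivity)]
  simp only [Pi.sub_apply, abs_sub_comm]

/-- Every law in the ball is the target of bicausal couplings of size barely more than the
radius. -/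
lemma exists_coupling_of_mem_adaptedBall (hp : 0 < p) (hP : P ∈ finiteMomentLaws T p) {r η : ℝ}
    (hr : 0 ≤ r) (hη : 0 < η) (hQ : Q ∈ adaptedBall p P r) :
    ∃ π : Measure (Path T × Path T), IsCoupling P Q π ∧ IsBicausal π ∧
      displacementNorm p π (fun z => z.2 - z.1) ≤ r + η := by
  have hlt : adaptedWasserstein p P Q < ENNReal.ofReal (r + η) :=
    hQ.2.trans_lt ((ENNReal.ofReal_lt_ofReal_iff (by linarith)).2 (by linarith))
  simp only [adaptedWasserstein, iInf_lt_iff] at hlt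
  obtain ⟨π, ⟨h1, h2⟩, h3⟩ := hlt
  obtain ⟨hX, hY⟩ := h1.memLp hP hQ.1
  rw [transportCost_eq hp (hY.sub hX), ENNReal.ofReal_lt_ofReal_iff (by linarith)] at h3
  exact ⟨π, h1, h2, h3.le⟩

lemma bddAbove_stoppingValue (hp : 1 < p) (hC1 : ∀ t : Fin T, ContDiff ℝ 1 (fun x => f x t))
    (hC : 0 ≤ C) (hG : ∀ k x, ‖pathDeriv f k x‖ ≤ C * (1 + ‖x‖ ^ (p - 1)))
    (hP : P ∈ finiteMomentLaws T p) (k : Fin T) {r : ℝ} (hr : 0 ≤ r) :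
    BddAbove (stoppingValue f '' adaptedBall p P r) := by
  have hp0 : 0 < p := by linarith
  have hPp := hP.1
  obtain ⟨M, hM, hb⟩ := exists_abs_le hp hC1 hC hG
  refine ⟨M * (1 + 2 ^ p * (∫ x, ‖x‖ ^ p ∂P + (r + 1) ^ p)), ?_⟩
  rintro _ ⟨Q, hQ, rfl⟩
  have hQp := hQ.1.1
  obtain ⟨π, h1, h2, h3⟩ := exists_coupling_of_mem_adaptedBall hp0 hP hr one_pos hQ
  have hπp := h1.isProbabilityMeasure
  obtain ⟨hX, hY⟩ := h1.memLp hP hQ.1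
  have hΔ : MemLp (fun z : Path T × Path T => z.2 - z.1) (ENNReal.ofReal p) π := hY.sub hX
  have hconst : (fun _ => k) ∈ stoppingTimes T := by
    rw [mem_stoppingTimes]; exact fun t => MeasurableSet.const _
  refine (stoppingValue_le hp hC1 hC hG hQ.1 hconst).trans ?_
  have hi := integrable_norm_rpow hp0 hQ.1.2
  have hYQ : ∫ x, ‖x‖ ^ p ∂Q = ∫ z, ‖z.2‖ ^ p ∂π := by
    rw [← h1.2, integral_map measurable_snd.aemeasurable
      (measurable_norm.pow_const p).aestronglyMeasurable]
  have hXP : ∫ x, ‖x‖ ^ p ∂P = ∫ z, ‖z.1‖ ^ p ∂π := by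
    rw [← h1.1, integral_map measurable_fst.aemeasurable
      (measurable_norm.pow_const p).aestronglyMeasurable]
  calc ∫ x, f x k ∂Q ≤ ∫ x, M * (1 + ‖x‖ ^ p) ∂Q :=
        integral_mono (integrable_payoff hp hC1 hC hG measurable_id hQ.1.2 measurable_const)
          (((integrable_const 1).add hi).const_mul M) fun x => (le_abs_self _).trans (hb x k)
    _ = M * (1 + ∫ z, ‖z.2‖ ^ p ∂π) := by
        rw [integral_const_mul, integral_add (integrable_const 1) hi, hYQ]
        simp
    _ ≤ M * (1 + 2 ^ p * (∫ z, ‖z.1‖ ^ p ∂π + ∫ z, ‖z.2 - z.1‖ ^ p ∂π)) := by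
        gcongr
        rw [← integral_add (integrable_norm_rpow hp0 hX) (integrable_norm_rpow hp0 hΔ),
          ← integral_const_mul]
        refine integral_mono (integrable_norm_rpow hp0 hY)
          (((integrable_norm_rpow hp0 hX).add (integrable_norm_rpow hp0 hΔ)).const_mul _)
          fun z => ?_
        refine le_trans ?_ (add_rpow_le_two_rpow hp0.le (norm_nonneg _) (norm_nonneg _))
        refine Real.rpow_le_rpow (norm_nonneg _) ?_ hp0.le
        calc ‖z.2‖ = ‖z.1 + (z.2 - z.1)‖ := by congr 1; abel
          _ ≤ _ := norm_add_le _ _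
    _ ≤ _ := by
        rw [hXP]
        gcongr
        exact (integral_norm_rpow_le hp0 hΔ).trans
          (Real.rpow_le_rpow displacementNorm_nonneg h3 hp0.le)

/-- First-order upper bound: along a bicausal coupling `π` of `P` and `Q`, exercise at `τ(X)` is an
admissible randomised strategy for `Y`; a Taylor expansion, the projection onto `F_t` and Hölder's
inequality bound the increment of its cost. -/
theorem exists_stoppingValue_le (hpq : p.HolderConjugate q)
    (hC1 : ∀ t : Fin T, ContDiff ℝ 1 (fun x => f x t)) (hC : 0 ≤ C)
    (hG : ∀ k x, ‖pathDeriv f k x‖ ≤ C * (1 + ‖x‖ ^ (p - 1)))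
    (hP : P ∈ finiteMomentLaws T p) {τ : Path T → Fin T} (hτ : IsOptimalStoppingTime f P τ)
    {ε : ℝ} (hε : 0 < ε) :
    ∃ δ : ℝ, 0 < δ ∧ ∀ r : ℝ, 0 ≤ r → r < δ → ∀ Q ∈ adaptedBall p P r,
      stoppingValue f Q ≤ stoppingValue f P + r * (sensitivity q f P τ + ε) := by
  have hp := hpq.lt
  have hp0 : 0 < p := by linarith
  have hPp := hP.1
  have hτm := measurable_of_mem_stoppingTimes hτ.1
  obtain ⟨δ, hδ, hrem⟩ := exists_integral_remainder_le hpq hC1 hC hG hP.2 hε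
  have hV : 0 ≤ sensitivity q f P τ := displacementNorm_nonneg
  have key : ∀ Q ∈ finiteMomentLaws T p, ∀ π : Measure (Path T × Path T), IsCoupling P Q π →
      IsBicausal π → displacementNorm p π (fun z => z.2 - z.1) ≤ δ →
      stoppingValue f Q ≤ stoppingValue f P +
        displacementNorm p π (fun z => z.2 - z.1) * (sensitivity q f P τ + ε) := by
    intro Q hQ π hπ hbi hN
    have hQp := hQ.1
    have hπp := hπ.isProbabilityMeasure
    obtain ⟨hX, hY⟩ := hπ.memLp hP hQ
    have hΔ : MemLp (fun z : Path T × Path T => z.2 - z.1) (ENNReal.ofReal p) π := hY.sub hX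
    set N := displacementNorm p π (fun z : Path T × Path T => z.2 - z.1) with hNdef
    have hL := integral_norm_rpow_rpow_le hp0 hΔ
    have hκ : Measurable fun z : Path T × Path T => τ z.1 := hτm.comp measurable_fst
    have h1 : stoppingValue f Q ≤ ∫ z, f z.2 (τ z.1) ∂π := by
      have : IsProbabilityMeasure (π.map Prod.swap) :=
        Measure.isProbabilityMeasure_map measurable_swap.aemeasurable
      refine (stoppingValue_le_of_isCausal hp hC1 hC hG hQ hbi.2 ?_ hτ.1).trans (le_of_eq ?_)
      · rw [Measure.map_map measurable_fst measurable_swap, ← hπ.2]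
        rfl
      · have hm : AEStronglyMeasurable (fun z : Path T × Path T => f z.1 (τ z.2))
            (π.map Prod.swap) :=
          (measurable_eval_index (g := fun k x => f x k)
            (fun k => (hC1 k).continuous.measurable) measurable_fst
            (hτm.comp measurable_snd)).aestronglyMeasurable
        rw [integral_map measurable_swap.aemeasurable hm]
        rfl
    have i1 : Integrable (fun z : Path T × Path T => f z.2 (τ z.1)) π :=
      integrable_payoff hp hC1 hC hG measurable_snd hY hκ
    have i2 : Integrable (fun z : Path T × Path T => f z.1 (τ z.1)) π :=
      integrable_payoff hp hC1 hC hG measurable_fst hX hκ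
    have i3 : Integrable (fun z : Path T × Path T => pathDeriv f (τ z.1) z.1 (z.2 - z.1)) π :=
      integrable_pathDeriv_apply hpq hC1 hG measurable_fst hX
        (measurable_snd.sub measurable_fst) hΔ hκ
    have h2 : ∫ z, f z.1 (τ z.1) ∂π = stoppingValue f P := by
      have hm : AEStronglyMeasurable (fun x : Path T => f x (τ x)) (π.map Prod.fst) :=
        (measurable_eval_index (g := fun k x => f x k)
          (fun k => (hC1 k).continuous.measurable) measurable_id hτm).aestronglyMeasurable
      rw [← hτ.2, ← hπ.1, integral_map measurable_fst.aemeasurable hm]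
    have h3 : ∫ z, pathDeriv f (τ z.1) z.1 (z.2 - z.1) ∂π ≤ sensitivity q f P τ * N := by
      have hXt : ∀ t, MemLp (fun z : Path T × Path T => z.1 t) (ENNReal.ofReal p) π :=
        fun t => memLp_pi_iff.1 hX t
      have hYt : ∀ t, MemLp (fun z : Path T × Path T => z.2 t) (ENNReal.ofReal p) π :=
        fun t => memLp_pi_iff.1 hY t
      have hg := fun t => memLp_partialDeriv hpq hC1 hG hP.2 hτm t
      have hĝ : ∀ t, MemLp (projectedDeriv f P τ t) (ENNReal.ofReal q) P := fun t =>
        memLp_projectedDeriv hpq hC1 hG hP.2 hτm t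
      have hĝm : ∀ t, Measurable (projectedDeriv f P τ t) := fun t =>
        (stronglyMeasurable_condExp.mono ((canonicalFiltration T).le t)).measurable
      have hgX : ∀ t, MemLp (fun z : Path T × Path T => partialDeriv f t z.1 (τ z.1))
          (ENNReal.ofReal q) π := fun t => by
        have := (hg t).2
        rw [← hπ.1] at this
        exact (memLp_map_measure_iff (hg t).1.aestronglyMeasurable
          measurable_fst.aemeasurable).1 this
      have hĝX : MemLp (fun (z : Path T × Path T) t => projectedDeriv f P τ t z.1)
          (ENNReal.ofReal q) π := by
        refine memLp_pi_iff.2 fun t => ?_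
        have h : MemLp (projectedDeriv f P τ t) (ENNReal.ofReal q) (π.map Prod.fst) := by
          rw [hπ.1]
          exact hĝ t
        exact (memLp_map_measure_iff (hĝm t).aestronglyMeasurable
          measurable_fst.aemeasurable).1 h
      have hs : displacementNorm q π (fun (z : Path T × Path T) t => projectedDeriv f P τ t z.1) =
          sensitivity q f P τ := by
        rw [sensitivity, displacementNorm, displacementNorm]
        congr 1
        refine Finset.sum_congr rfl fun t _ => ?_
        have hm : AEStronglyMeasurable (fun x => |projectedDeriv f P τ t x| ^ q)
            (π.map Prod.fst) := ((hĝm t).abs.pow_const q).aestronglyMeasurable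
        rw [← integral_map measurable_fst.aemeasurable hm, hπ.1]
      calc ∫ z, pathDeriv f (τ z.1) z.1 (z.2 - z.1) ∂π
          = ∑ t, ∫ z, partialDeriv f t z.1 (τ z.1) * (z.2 t - z.1 t) ∂π := by
            simp only [pathDeriv_apply hC1, Pi.sub_apply]
            exact integral_finsetSum _ fun t _ =>
              integrable_mul_of_holderConjugate hpq.symm (hgX t) ((hYt t).sub (hXt t))
        _ = ∑ t, ∫ z, projectedDeriv f P τ t z.1 * (z.2 t - z.1 t) ∂π :=
            Finset.sum_congr rfl fun t _ =>
              hbi.1.integral_mul_sub_eq hpq hπ.1 (hg t).1 (hg t).2 t (hXt t) (hYt t)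
        _ ≤ sensitivity q f P τ * N := by
            rw [← hs]
            exact sum_integral_mul_le hpq hΔ hĝX
    have h4 := hrem π (fun z => z.1) (fun z => z.2) (fun z => τ z.1) measurable_fst measurable_snd
      hκ hπ.1 hΔ (hL.trans hN)
    have i12 : Integrable (fun z : Path T × Path T => f z.2 (τ z.1) - f z.1 (τ z.1)) π :=
      i1.sub i2
    rw [integral_sub i12 i3, integral_sub i1 i2] at h4
    have h5 := (abs_le.1 h4).2
    have h6 := mul_le_mul_of_nonneg_left hL hε.le
    rw [h2] at h5
    linarith
  refine ⟨δ, hδ, fun r hr hrδ Q hQ => ?_⟩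
  have hev : ∀ᶠ η in 𝓝[>] (0 : ℝ), stoppingValue f Q ≤
      stoppingValue f P + (r + η) * (sensitivity q f P τ + ε) := by
    filter_upwards [Ioo_mem_nhdsGT (sub_pos.2 hrδ)] with η hη
    obtain ⟨π, h1, h2, h3⟩ := exists_coupling_of_mem_adaptedBall hp0 hP hr hη.1 hQ
    refine (key Q hQ.1 π h1 h2 (h3.trans (by linarith [hη.2]))).trans ?_
    gcongr
  refine ge_of_tendsto ?_ hev
  have : Tendsto (fun η : ℝ => stoppingValue f P + (r + η) * (sensitivity q f P τ + ε)) (𝓝 0)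
      (𝓝 (stoppingValue f P + (r + 0) * (sensitivity q f P τ + ε))) :=
    (Continuous.tendsto (by fun_prop) 0)
  rw [add_zero] at this
  exact this.mono_left nhdsWithin_le_nhds

end UpperBound

/-! ### Stability of the optimal stopping time -/

/-- A Borel–Cantelli argument for functionals that are subadditive under pointwise minima and lower
semicontinuous along pointwise limits: the lower limit `ρ` of a sequence with `e (τ n) ≤ 2^{-n}`
satisfies `e ρ ≤ 0`. Applied to `ι` and to its order dual, this treats lower and upper limits of
nearly optimal stopping times. -/
lemma exists_liminf_of_le_pow {Ω ι : Type*} [LinearOrder ι] [Finite ι] (S : Set (Ω → ι))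
    (e : (Ω → ι) → ℝ)
    (hmin : ∀ τ ∈ S, ∀ σ ∈ S, (fun x => min (τ x) (σ x)) ∈ S ∧
      e (fun x => min (τ x) (σ x)) ≤ e τ + e σ)
    (hlim : ∀ (τ : ℕ → Ω → ι) (ρ : Ω → ι) (a : ℕ → ℝ) (b : ℝ), (∀ n, τ n ∈ S) →
      (∀ x, ∀ᶠ n in atTop, τ n x = ρ x) → (∀ n, e (τ n) ≤ a n) → Tendsto a atTop (𝓝 b) →
      ρ ∈ S ∧ e ρ ≤ b)
    (τ : ℕ → Ω → ι) (hτ : ∀ n, τ n ∈ S) (he : ∀ n, e (τ n) ≤ (1 / 2) ^ n) :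
    ∃ ρ ∈ S, e ρ ≤ 0 ∧ ∀ x, ∀ᶠ n in atTop, ρ x ≤ τ n x := by
  -- `m N k` is the minimum of `τ N, …, τ (N + k)`, and `v N` the infimum of `τ N, τ (N + 1), …`
  let m : ℕ → ℕ → Ω → ι := fun N k =>
    Nat.rec (τ N) (fun j (r : Ω → ι) x => min (r x) (τ (N + j + 1) x)) k
  have hm : ∀ N k, m N k ∈ S ∧ e (m N k) ≤ 2 * (1 / 2) ^ N - (1 / 2) ^ (N + k) := by
    intro N k
    induction k with
    | zero =>
      refine ⟨hτ N, (he N).trans ?_⟩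
      rw [add_zero]
      linarith
    | succ k ih =>
      obtain ⟨h1, h2⟩ := hmin _ ih.1 _ (hτ (N + k + 1))
      refine ⟨h1, h2.trans ((add_le_add ih.2 (he _)).trans (le_of_eq ?_))⟩
      rw [← add_assoc, pow_succ _ (N + k)]
      ring
  have hv : ∀ N x, ∃ v : ι, (∃ j, τ (N + j) x = v) ∧ ∀ j, v ≤ τ (N + j) x := fun N x => by
    obtain ⟨v, ⟨j, hj⟩, h2⟩ := Set.exists_min_image (Set.range fun j => τ (N + j) x) id
      (Set.toFinite _) (Set.range_nonempty _)
    exact ⟨v, ⟨j, hj⟩, fun i => h2 _ ⟨i, rfl⟩⟩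
  choose v hv1 hv2 using hv
  have hmle : ∀ N x k j, j ≤ k → m N k x ≤ τ (N + j) x := by
    intro N x k
    induction k with
    | zero => intro j hj; obtain rfl : j = 0 := by omega
              exact le_rfl
    | succ k ih =>
      intro j hj
      rcases Nat.le_succ_iff.1 hj with h | h
      · exact (min_le_left _ _).trans (ih j h)
      · subst h; exact min_le_right _ _
  have hlem : ∀ N x k, v N x ≤ m N k x := by
    intro N x k
    induction k with
    | zero => exact hv2 N x 0
    | succ k ih => exact le_min ih (hv2 N x (k + 1))
  have hvS : ∀ N, v N ∈ S ∧ e (v N) ≤ 2 * (1 / 2) ^ N := fun N => by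
    refine hlim (m N) (v N) (fun _ => 2 * (1 / 2) ^ N) _ (fun k => (hm N k).1) (fun x => ?_)
      (fun k => (hm N k).2.trans (sub_le_self _ (by positivity))) tendsto_const_nhds
    obtain ⟨j, hj⟩ := hv1 N x
    filter_upwards [eventually_ge_atTop j] with k hk
    exact le_antisymm ((hmle N x k j hk).trans hj.le) (hlem N x k)
  have hvmono : ∀ x N M, N ≤ M → v N x ≤ v M x := fun x N M hNM => by
    obtain ⟨j, hj⟩ := hv1 M x
    have := hv2 N x (M - N + j)
    rwa [← add_assoc, Nat.add_sub_cancel' hNM, hj] at this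
  have hρ : ∀ x, ∃ w : ι, ∃ N₀, ∀ N, N₀ ≤ N → v N x = w := fun x => by
    obtain ⟨w, ⟨N₀, hN₀⟩, h2⟩ := Set.exists_max_image (Set.range fun N => v N x) id
      (Set.toFinite _) (Set.range_nonempty _)
    exact ⟨w, N₀, fun N hN => le_antisymm (h2 _ ⟨N, rfl⟩) (hN₀ ▸ hvmono x N₀ N hN)⟩
  choose ρ N₀ hN₀ using hρ
  obtain ⟨h1, h2⟩ := hlim v ρ (fun N => 2 * (1 / 2) ^ N) 0 (fun N => (hvS N).1)
    (fun x => (eventually_ge_atTop (N₀ x)).mono fun N hN => hN₀ x N hN) (fun N => (hvS N).2)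
    (by simpa using (tendsto_pow_atTop_nhds_zero_of_lt_one (r := (1 / 2 : ℝ)) (by norm_num)
      (by norm_num)).const_mul 2)
  refine ⟨ρ, h1, h2, fun x => ?_⟩
  filter_upwards [eventually_ge_atTop (N₀ x)] with n hn
  have := hv2 (N₀ x) x (n - N₀ x)
  rwa [Nat.add_sub_cancel' hn, hN₀ x _ le_rfl] at this

section Stability

variable {T : ℕ} {p q : ℝ} {f : Path T → Fin T → ℝ} {C : ℝ} {P Q : Measure (Path T)}

lemma min_mem_stoppingTimes {τ σ : Path T → Fin T} (hτ : τ ∈ stoppingTimes T)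
    (hσ : σ ∈ stoppingTimes T) : (fun x => min (τ x) (σ x)) ∈ stoppingTimes T := by
  rw [mem_stoppingTimes] at *
  intro t
  have : {x | min (τ x) (σ x) ≤ t} = {x | τ x ≤ t} ∪ {x | σ x ≤ t} := by
    ext x; simp
  rw [this]
  exact (hτ t).union (hσ t)

lemma max_mem_stoppingTimes {τ σ : Path T → Fin T} (hτ : τ ∈ stoppingTimes T)
    (hσ : σ ∈ stoppingTimes T) : (fun x => max (τ x) (σ x)) ∈ stoppingTimes T := by
  rw [mem_stoppingTimes] at *
  intro t
  have : {x | max (τ x) (σ x) ≤ t} = {x | τ x ≤ t} ∩ {x | σ x ≤ t} := by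
    ext x; simp
  rw [this]
  exact (hτ t).inter (hσ t)

lemma mem_stoppingTimes_of_eventually_eq {τ : ℕ → Path T → Fin T} {ρ : Path T → Fin T}
    (hτ : ∀ n, τ n ∈ stoppingTimes T) (h : ∀ x, ∀ᶠ n in atTop, τ n x = ρ x) :
    ρ ∈ stoppingTimes T := by
  simp only [mem_stoppingTimes] at *
  intro t
  have : {x | ρ x ≤ t} = ⋃ N : ℕ, ⋂ n : ℕ, {x | τ (N + n) x ≤ t} := by
    ext x
    simp only [Set.mem_ofPred_eq, Set.mem_iUnion, Set.mem_iInter]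
    obtain ⟨N, hN⟩ := eventually_atTop.1 (h x)
    constructor
    · intro hx
      exact ⟨N, fun n => (hN _ (Nat.le_add_right N n)).trans_le hx⟩
    · rintro ⟨M, hM⟩
      have := hM N
      rwa [hN _ (Nat.le_add_left N M)] at this
  rw [this]
  exact MeasurableSet.iUnion fun N => MeasurableSet.iInter fun n => hτ _ t

lemma tendsto_integral_payoff [IsFiniteMeasure P] (hp : 1 < p)
    (hC1 : ∀ t : Fin T, ContDiff ℝ 1 (fun x => f x t)) (hC : 0 ≤ C)
    (hG : ∀ k x, ‖pathDeriv f k x‖ ≤ C * (1 + ‖x‖ ^ (p - 1)))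
    (hP : MemLp (fun x : Path T => x) (ENNReal.ofReal p) P)
    {τ : ℕ → Path T → Fin T} {ρ : Path T → Fin T} (hτ : ∀ n, Measurable (τ n))
    (h : ∀ x, ∀ᶠ n in atTop, τ n x = ρ x) :
    Tendsto (fun n => ∫ x, f x (τ n x) ∂P) atTop (𝓝 (∫ x, f x (ρ x) ∂P)) := by
  obtain ⟨M, hM, hb⟩ := exists_abs_le hp hC1 hC hG
  refine tendsto_integral_of_dominated_convergence (fun x => M * (1 + ‖x‖ ^ p))
    (fun n => (integrable_payoff hp hC1 hC hG measurable_id hP (hτ n)).aestronglyMeasurable)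
    (((integrable_const (1 : ℝ)).add (integrable_norm_rpow (by linarith) hP)).const_mul M)
    (fun n => ae_of_all _ fun x => hb _ _) (ae_of_all _ fun x => ?_)
  refine tendsto_const_nhds.congr' ?_
  filter_upwards [h x] with n hn
  rw [hn]

/-- If the optimal stopping time is unique, nearly optimal stopping times agree with it outside a
small set. Lower and upper limits of a fast minimising sequence are both optimal, hence both equal
to `τstar`, so that the sequence is eventually equal to `τstar` almost surely. -/
theorem exists_integral_ne_lt (hp : 1 < p)
    (hC1 : ∀ t : Fin T, ContDiff ℝ 1 (fun x => f x t)) (hC : 0 ≤ C)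
    (hG : ∀ k x, ‖pathDeriv f k x‖ ≤ C * (1 + ‖x‖ ^ (p - 1)))
    (hP : P ∈ finiteMomentLaws T p) {τstar : Path T → Fin T}
    (hτ_opt : IsOptimalStoppingTime f P τstar)
    (hτ_unique : ∀ τ : Path T → Fin T, IsOptimalStoppingTime f P τ → τ =ᵐ[P] τstar)
    {h : Path T → ℝ} (hh : Integrable h P) {ε : ℝ} (hε : 0 < ε) :
    ∃ δ : ℝ, 0 < δ ∧ ∀ τ ∈ stoppingTimes T, ∫ x, f x (τ x) ∂P < stoppingValue f P + δ →
      ∫ x, Set.indicator {x | τ x ≠ τstar x} h x ∂P < ε := by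
  by_contra! hcon
  have hPp := hP.1
  choose! τ hτS hτe hτε using fun n : ℕ => hcon ((1 / 2) ^ n) (by positivity)
  have hint : ∀ σ ∈ stoppingTimes T, Integrable (fun x => f x (σ x)) P := fun σ hσ =>
    integrable_payoff hp hC1 hC hG measurable_id hP.2 (measurable_of_mem_stoppingTimes hσ)
  set e : (Path T → Fin T) → ℝ := fun σ => ∫ x, f x (σ x) ∂P - stoppingValue f P with he
  have he0 : ∀ σ ∈ stoppingTimes T, 0 ≤ e σ := fun σ hσ =>
    sub_nonneg.2 (stoppingValue_le hp hC1 hC hG hP hσ)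
  -- exercise at the earlier and at the later of two times costs as much as at the two times
  have hmm : ∀ σ ∈ stoppingTimes T, ∀ σ' ∈ stoppingTimes T,
      e (fun x => min (σ x) (σ' x)) + e (fun x => max (σ x) (σ' x)) = e σ + e σ' := by
    intro σ hσ σ' hσ'
    have h1 : ∫ x, f x (min (σ x) (σ' x)) ∂P + ∫ x, f x (max (σ x) (σ' x)) ∂P =
        ∫ x, f x (σ x) ∂P + ∫ x, f x (σ' x) ∂P := by
      rw [← integral_add (hint _ (min_mem_stoppingTimes hσ hσ'))
        (hint _ (max_mem_stoppingTimes hσ hσ')), ← integral_add (hint _ hσ) (hint _ hσ')]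
      refine integral_congr_ae (ae_of_all _ fun x => ?_)
      rcases le_total (σ x) (σ' x) with hx | hx
      · simp [hx]
      · simp [hx, add_comm]
    simp only [he]
    linarith
  have hlim : ∀ (σ : ℕ → Path T → Fin T) (ρ : Path T → Fin T) (a : ℕ → ℝ) (b : ℝ),
      (∀ n, σ n ∈ stoppingTimes T) → (∀ x, ∀ᶠ n in atTop, σ n x = ρ x) → (∀ n, e (σ n) ≤ a n) →
      Tendsto a atTop (𝓝 b) → ρ ∈ stoppingTimes T ∧ e ρ ≤ b := fun σ ρ a b hσ hx ha hb =>
    ⟨mem_stoppingTimes_of_eventually_eq hσ hx, le_of_tendsto_of_tendsto'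
      ((tendsto_integral_payoff hp hC1 hC hG hP.2
        (fun n => measurable_of_mem_stoppingTimes (hσ n)) hx).sub_const _) hb ha⟩
  have hτe' : ∀ n, e (τ n) ≤ (1 / 2) ^ n := fun n => by
    have := hτe n
    simp only [he]
    linarith
  obtain ⟨ρ, hρS, hρe, hρ⟩ := exists_liminf_of_le_pow (stoppingTimes T) e
    (fun σ hσ σ' hσ' => ⟨min_mem_stoppingTimes hσ hσ', by
      have := hmm σ hσ σ' hσ'
      have := he0 _ (max_mem_stoppingTimes hσ hσ')
      linarith⟩) hlim τ hτS hτe'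
  obtain ⟨ρ', hρS', hρe', hρ'⟩ := exists_liminf_of_le_pow (ι := (Fin T)ᵒᵈ) (stoppingTimes T) e
    (fun σ hσ σ' hσ' => ⟨max_mem_stoppingTimes hσ hσ', by
      have := hmm σ hσ σ' hσ'
      have := he0 _ (min_mem_stoppingTimes hσ hσ')
      change e (fun x => max (σ x) (σ' x)) ≤ _
      linarith⟩) hlim τ hτS hτe'
  have hopt : ∀ σ ∈ stoppingTimes T, e σ ≤ 0 → σ =ᵐ[P] τstar := fun σ hσ hσe =>
    hτ_unique σ ⟨hσ, sub_eq_zero.1 (le_antisymm hσe (he0 σ hσ))⟩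
  have hev : ∀ᵐ x ∂P, ∀ᶠ n in atTop, τ n x = τstar x := by
    filter_upwards [hopt ρ hρS hρe, hopt ρ' hρS' hρe'] with x hx hx'
    filter_upwards [hρ x, hρ' x] with n hn hn'
    exact le_antisymm (le_trans (OrderDual.toDual_le_toDual.1 hn') hx'.le) (hx ▸ hn)
  have hlim0 : Tendsto (fun n => ∫ x, Set.indicator {x | τ n x ≠ τstar x} h x ∂P) atTop
      (𝓝 (∫ _x, (0 : ℝ) ∂P)) := by
    refine tendsto_integral_of_dominated_convergence (fun x => ‖h x‖) (fun n => ?_) hh.norm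
      (fun n => ae_of_all _ fun x => norm_indicator_le_norm_self h x) ?_
    · exact hh.aestronglyMeasurable.indicator (measurableSet_eq_fun
        (measurable_of_mem_stoppingTimes (hτS n))
        (measurable_of_mem_stoppingTimes hτ_opt.1)).compl
    · filter_upwards [hev] with x hx
      refine tendsto_const_nhds.congr' ?_
      filter_upwards [hx] with n hn
      rw [Set.indicator_of_notMem]
      simpa using hn
  rw [integral_zero] at hlim0
  obtain ⟨n, hn⟩ := (hlim0.eventually (gt_mem_nhds hε)).exists
  exact absurd hn (not_lt.2 (hτε n))

end Stability

/-! ### Lipschitz directions -/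

section Density

variable {E : Type*} [PseudoMetricSpace E] [MeasurableSpace E] [BorelSpace E]

/-- Lipschitz functions are dense in `L^p` of a finite measure on a metric space. -/
theorem exists_lipschitzWith_eLpNorm_sub_le (μ : Measure E) [IsFiniteMeasure μ] {p : ℝ≥0∞}
    (hp : p ≠ ∞) {f : E → ℝ} (hf : MemLp f p μ) {ε : ℝ≥0∞} (hε : ε ≠ 0) :
    ∃ g : E → ℝ, eLpNorm (f - g) p μ ≤ ε ∧ ∃ K, LipschitzWith K g := by
  refine hf.induction_dense hp (fun g : E → ℝ => ∃ K, LipschitzWith K g) ?_ ?_ ?_ hε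
  · intro c s hs hμs ε hε
    obtain ⟨η, hη, hηs⟩ := exists_eLpNorm_indicator_le (μ := μ) hp c hε
    have hη2 : ((η / 2 : NNReal) : ℝ≥0∞) ≠ 0 := by
      rw [ENNReal.coe_ne_zero]; positivity
    obtain ⟨F, hFs, hF, hFη⟩ := hs.exists_isClosed_sdiff_lt hμs.ne hη2
    have hev : ∀ᶠ r in 𝓝[>] (0 : ℝ), μ (Metric.thickening r F) < μ F + (η / 2 : NNReal) :=
      (tendsto_measure_thickening_of_isClosed ⟨1, one_pos, measure_ne_top _ _⟩ hF).eventually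
        (gt_mem_nhds (ENNReal.lt_add_right (measure_ne_top _ _) hη2))
    obtain ⟨δ, hδF, hδ⟩ := (hev.and self_mem_nhdsWithin).exists
    have hδ' : 0 < δ := hδ
    set A := (s \ F) ∪ (Metric.thickening δ F \ F) with hA
    refine ⟨fun x => c * (thickenedIndicator hδ' F x : ℝ), ?_, ‖c‖₊ * δ.toNNReal⁻¹, ?_⟩
    · refine (eLpNorm_mono fun x => ?_).trans (hηs A ?_)
      · by_cases hxF : x ∈ F
        · rw [Pi.sub_apply, thickenedIndicator_one hδ' F hxF, Set.indicator_of_mem (hFs hxF)]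
          simp
        have h0 : (thickenedIndicator hδ' F x : ℝ) ≤ 1 := by
          exact_mod_cast thickenedIndicator_le_one hδ' F x
        have h1 : (0 : ℝ) ≤ thickenedIndicator hδ' F x := NNReal.coe_nonneg _
        by_cases hxA : x ∈ A
        · rw [Set.indicator_of_mem hxA, Pi.sub_apply]
          have : s.indicator (fun _ => c) x = c * s.indicator (fun _ => (1 : ℝ)) x := by
            by_cases hxs : x ∈ s <;> simp [hxs]
          rw [this, ← mul_sub, norm_mul]
          refine mul_le_of_le_one_right (norm_nonneg c) ?_
          rw [Real.norm_eq_abs, abs_le]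
          by_cases hxs : x ∈ s
          · rw [Set.indicator_of_mem hxs]; constructor <;> linarith
          · rw [Set.indicator_of_notMem hxs]; constructor <;> linarith
        · have hxs : x ∉ s := fun h => hxA (Or.inl ⟨h, hxF⟩)
          have hxt : x ∉ Metric.thickening δ F := fun h => hxA (Or.inr ⟨h, hxF⟩)
          rw [Pi.sub_apply, thickenedIndicator_zero hδ' F hxt, Set.indicator_of_notMem hxs]
          simp
      · have h1 : μ (Metric.thickening δ F \ F) ≤ (η / 2 : NNReal) := by
          rw [measure_sdiff (Metric.self_subset_thickening hδ' F)
            hF.measurableSet.nullMeasurableSet (measure_ne_top _ _)]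
          exact tsub_le_iff_left.2 hδF.le
        calc μ A ≤ μ (s \ F) + μ (Metric.thickening δ F \ F) := measure_union_le _ _
          _ ≤ (η / 2 : NNReal) + (η / 2 : NNReal) := add_le_add hFη.le h1
          _ = η := by rw [← ENNReal.coe_add, add_halves]
    · refine LipschitzWith.of_dist_le_mul fun x y => ?_
      have h := (lipschitzWith_thickenedIndicator hδ' F).dist_le_mul x y
      rw [NNReal.dist_eq] at h
      rw [Real.dist_eq, ← mul_sub, abs_mul, NNReal.coe_mul, mul_assoc]
      exact mul_le_mul_of_nonneg_left h (abs_nonneg c)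
  · rintro g h ⟨K, hK⟩ ⟨L, hL⟩
    exact ⟨K + L, hK.add hL⟩
  · rintro g ⟨K, hK⟩
    exact hK.continuous.measurable.aestronglyMeasurable

end Density

section Direction

variable {T : ℕ} {p q : ℝ} {P : Measure (Path T)}

lemma displacementNorm_const_mul (hp : 0 < p) {Ω : Type*} [MeasurableSpace Ω] (μ : Measure Ω)
    {c : ℝ} (hc : 0 ≤ c) (Δ : Ω → Path T) :
    displacementNorm p μ (fun ω t => c * Δ ω t) = c * displacementNorm p μ Δ := by
  have h : ∀ t, ∫ ω, |c * Δ ω t| ^ p ∂μ = c ^ p * ∫ ω, |Δ ω t| ^ p ∂μ := fun t => by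
    rw [← integral_const_mul]
    congr 1
    ext ω
    rw [abs_mul, abs_of_nonneg hc, Real.mul_rpow hc (abs_nonneg _)]
  simp only [displacementNorm, h]
  rw [← Finset.mul_sum, Real.mul_rpow (by positivity) sum_integral_nonneg, ← Real.rpow_mul hc,
    mul_one_div_cancel hp.ne', Real.rpow_one]

lemma integral_abs_rpow_eq (hp : 0 < p) {Ω : Type*} [MeasurableSpace Ω] {μ : Measure Ω}
    {g : Ω → ℝ} (hg : MemLp g (ENNReal.ofReal p) μ) :
    (∫ ω, |g ω| ^ p ∂μ) ^ (1 / p) = (eLpNorm g (ENNReal.ofReal p) μ).toReal := by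
  rw [hg.eLpNorm_eq_integral_rpow_norm (by simpa using hp) ENNReal.ofReal_ne_top,
    ENNReal.toReal_ofReal hp.le, ENNReal.toReal_ofReal, one_div]
  · simp only [Real.norm_eq_abs]
  · exact Real.rpow_nonneg (integral_nonneg fun _ => by positivity) _

/-- `L^p` convergence of the coordinates entails convergence of the displacement norms. -/
lemma tendsto_displacementNorm (hp : 1 ≤ p) {Ω : Type*} [MeasurableSpace Ω] {μ : Measure Ω}
    {Z : ℕ → Ω → Path T} {W : Ω → Path T}
    (hZ : ∀ n t, MemLp (fun ω => Z n ω t) (ENNReal.ofReal p) μ)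
    (hW : ∀ t, MemLp (fun ω => W ω t) (ENNReal.ofReal p) μ)
    (h : ∀ t, Tendsto (fun n => eLpNorm (fun ω => Z n ω t - W ω t) (ENNReal.ofReal p) μ)
      atTop (𝓝 0)) :
    Tendsto (fun n => displacementNorm p μ (Z n)) atTop (𝓝 (displacementNorm p μ W)) := by
  have hp0 : 0 < p := by linarith
  have : Fact (1 ≤ ENNReal.ofReal p) :=
    ⟨by rw [← ENNReal.ofReal_one]; exact ENNReal.ofReal_le_ofReal hp⟩
  have hpow : ∀ {g : Ω → ℝ}, MemLp g (ENNReal.ofReal p) μ →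
      ∫ ω, |g ω| ^ p ∂μ = (eLpNorm g (ENNReal.ofReal p) μ).toReal ^ p := fun {g} hg => by
    rw [← integral_abs_rpow_eq hp0 hg, ← Real.rpow_mul (integral_nonneg fun _ => by positivity),
      one_div_mul_cancel hp0.ne', Real.rpow_one]
  simp only [displacementNorm]
  refine Tendsto.rpow_const (tendsto_finsetSum _ fun t _ => ?_) (Or.inr (by positivity))
  simp only [hpow (hZ _ t), hpow (hW t)]
  refine Tendsto.rpow_const ?_ (Or.inr hp0.le)
  have h1 := (Lp.tendsto_Lp_iff_tendsto_eLpNorm'' _ (hZ · t) _ (hW t)).2 (h t)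
  simpa only [Lp.norm_toLp] using h1.norm

lemma tendsto_integral_mul (hpq : p.HolderConjugate q) {Ω : Type*} [MeasurableSpace Ω]
    {μ : Measure Ω} {g W : Ω → ℝ} {Z : ℕ → Ω → ℝ} (hg : MemLp g (ENNReal.ofReal q) μ)
    (hZ : ∀ n, MemLp (Z n) (ENNReal.ofReal p) μ) (hW : MemLp W (ENNReal.ofReal p) μ)
    (h : Tendsto (fun n => eLpNorm (fun ω => Z n ω - W ω) (ENNReal.ofReal p) μ) atTop (𝓝 0)) :
    Tendsto (fun n => ∫ ω, g ω * Z n ω ∂μ) atTop (𝓝 (∫ ω, g ω * W ω ∂μ)) := by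
  rw [tendsto_iff_norm_sub_tendsto_zero]
  have hreal : Tendsto (fun n => (∫ ω, |g ω| ^ q ∂μ) ^ (1 / q) *
      (eLpNorm (fun ω => Z n ω - W ω) (ENNReal.ofReal p) μ).toReal) atTop (𝓝 0) := by
    have := ((ENNReal.tendsto_toReal ENNReal.zero_ne_top).comp h).const_mul
      ((∫ ω, |g ω| ^ q ∂μ) ^ (1 / q))
    simpa using this
  refine squeeze_zero (fun n => norm_nonneg _) (fun n => ?_) hreal
  have hd : MemLp (fun ω => Z n ω - W ω) (ENNReal.ofReal p) μ := (hZ n).sub hW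
  rw [← integral_abs_rpow_eq hpq.pos hd,
    ← integral_sub (integrable_mul_of_holderConjugate hpq.symm hg (hZ n))
      (integrable_mul_of_holderConjugate hpq.symm hg hW)]
  refine (norm_integral_le_integral_norm _).trans ?_
  simp only [← mul_sub, norm_mul]
  exact integral_mul_le_Lp_mul_Lq_of_nonneg hpq.symm (ae_of_all _ fun ω => norm_nonneg _)
    (ae_of_all _ fun ω => norm_nonneg _) hg.norm hd.norm

/-- The dual direction `W_t = g_t |g_t|^{q-2} / V^{q-1}` attains equality in Hölder's inequality. -/
lemma dual_direction (hpq : p.HolderConjugate q) {Ω : Type*} [MeasurableSpace Ω]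
    {μ : Measure Ω} {g : Ω → Path T} (hg : MemLp g (ENNReal.ofReal q) μ)
    (hV : 0 < displacementNorm q μ g) {W : Ω → Path T}
    (hW : W = fun ω t => g ω t * |g ω t| ^ (q - 2) * (displacementNorm q μ g ^ (q - 1))⁻¹) :
    (∀ t, MemLp (fun ω => W ω t) (ENNReal.ofReal p) μ) ∧ displacementNorm p μ W = 1 ∧
      ∑ t, ∫ ω, g ω t * W ω t ∂μ = displacementNorm q μ g := by
  have hq := hpq.symm.lt
  have hp0 := hpq.pos
  set V := displacementNorm q μ g with hVdef
  have hVq : V ^ q = ∑ t, ∫ ω, |g ω t| ^ q ∂μ := displacementNorm_rpow (by linarith)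
  have hqp : (q - 1) * p = q := hpq.symm.sub_one_mul_conj
  have habs : ∀ ω t, |W ω t| = |g ω t| ^ (q - 1) * (V ^ (q - 1))⁻¹ := fun ω t => by
    rw [hW, abs_mul, abs_mul, abs_of_nonneg (Real.rpow_nonneg (abs_nonneg (g ω t)) _),
      abs_of_pos (inv_pos.2 (Real.rpow_pos_of_pos hV _))]
    congr 1
    rcases eq_or_ne (g ω t) 0 with h | h
    · simp [h, Real.zero_rpow (by linarith : q - 1 ≠ 0)]
    · rw [← Real.rpow_one_add' (abs_nonneg _) (by linarith)]
      congr 1; ring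
  have hprod : ∀ ω t, g ω t * W ω t = |g ω t| ^ q * (V ^ (q - 1))⁻¹ := fun ω t => by
    rw [hW, ← mul_assoc, ← mul_assoc]
    congr 1
    rcases eq_or_ne (g ω t) 0 with h | h
    · simp [h, Real.zero_rpow (by linarith : q ≠ 0)]
    · have : g ω t * g ω t = |g ω t| ^ (2 : ℝ) := by
        rw [Real.rpow_two, sq_abs]; ring
      rw [this, ← Real.rpow_add (abs_pos.2 h)]
      congr 1; ring
  refine ⟨fun t => ?_, ?_, ?_⟩
  · have hgt := memLp_pi_iff.1 hg t
    have h := hgt.norm_rpow_div (ENNReal.ofReal (q - 1))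
    have hexp : ENNReal.ofReal q / ENNReal.ofReal (q - 1) = ENNReal.ofReal p := by
      rw [← ENNReal.ofReal_div_of_pos hpq.symm.sub_one_pos, ← hpq.symm.conjugate_eq]
    rw [ENNReal.toReal_ofReal hpq.symm.sub_one_pos.le, hexp] at h
    have hm : AEStronglyMeasurable (fun ω => W ω t) μ := by
      have h1 : AEMeasurable (fun ω => g ω t) μ := hgt.aestronglyMeasurable.aemeasurable
      have h2 : AEMeasurable (fun ω => |g ω t| ^ (q - 2)) μ := h1.abs.pow_const _
      rw [hW]
      exact ((h1.mul h2).mul_const _).aestronglyMeasurable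
    refine (h.mul_const ((V ^ (q - 1))⁻¹)).mono' hm (ae_of_all _ fun ω => ?_)
    rw [Real.norm_eq_abs, habs]
    simp
  · have h : ∀ ω t, |W ω t| ^ p = |g ω t| ^ q * (V ^ q)⁻¹ := fun ω t => by
      rw [habs, Real.mul_rpow (by positivity) (by positivity), ← Real.rpow_mul (abs_nonneg _),
        Real.inv_rpow (by positivity), ← Real.rpow_mul hV.le, hqp]
    simp only [displacementNorm, h, integral_mul_const]
    rw [← Finset.sum_mul, ← hVq, mul_inv_cancel₀ (by positivity), Real.one_rpow]
  · simp only [hprod, integral_mul_const]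
    rw [← Finset.sum_mul, ← hVq, ← Real.rpow_neg hV.le, ← Real.rpow_add hV]
    conv_rhs => rw [← Real.rpow_one V]
    congr 1; ring

/-- Adapted processes `Z_t = z_t(X_1, …, X_t)` with Lipschitz `z_t` and size at most one nearly
attain the norm of an adapted process `g` by duality. -/
theorem exists_lipschitz_direction [IsProbabilityMeasure P] (hpq : p.HolderConjugate q)
    {g : Path T → Path T}
    (hgm : ∀ t, Measurable[canonicalFiltration T t] fun x => g x t)
    (hg : MemLp g (ENNReal.ofReal q) P) {η : ℝ} (hη : 0 < η) :
    ∃ (z : ∀ t : Fin T, (Set.Iic t → ℝ) → ℝ) (K : NNReal), (∀ t, LipschitzWith K (z t)) ∧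
      MemLp (fun x t => z t (Preorder.restrictLe t x)) (ENNReal.ofReal p) P ∧
      displacementNorm p P (fun x t => z t (Preorder.restrictLe t x)) ≤ 1 ∧
      displacementNorm q P g - η ≤
        ∑ t, ∫ x, g x t * z t (Preorder.restrictLe t x) ∂P := by
  have hp := hpq.lt
  have hp0 := hpq.pos
  rcases (displacementNorm_nonneg (p := q) (μ := P) (Δ := g)).eq_or_lt with hV | hV
  · refine ⟨fun _ _ => 0, 0, fun t => LipschitzWith.const 0, MemLp.zero, ?_, ?_⟩
    · simp [displacementNorm, Real.zero_rpow hp0.ne', hpq.ne_zero]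
    · simp [← hV, hη.le]
  obtain ⟨hWp, hWn, hWg⟩ := dual_direction hpq hg hV rfl
  set W : Path T → Path T :=
    fun ω t => g ω t * |g ω t| ^ (q - 2) * (displacementNorm q P g ^ (q - 1))⁻¹ with hW
  have hWm : ∀ t, Measurable[canonicalFiltration T t] fun x => W x t := fun t => by
    have h1 := hgm t
    have h2 : Measurable[canonicalFiltration T t] fun x => |g x t| ^ (q - 2) :=
      (continuous_abs.measurable.comp h1).pow_const _
    exact (h1.mul h2).mul_const _
  choose w hwm hw using fun t => (hWm t).exists_eq_measurable_comp (mY := MeasurableSpace.pi)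
  have hrm : ∀ t : Fin T, Measurable (Preorder.restrictLe t : Path T → _) :=
    fun t => Preorder.measurable_restrictLe t
  have hwp : ∀ t, MemLp (w t) (ENNReal.ofReal p) (P.map (Preorder.restrictLe t)) := fun t => by
    refine (memLp_map_measure_iff (hwm t).aestronglyMeasurable (hrm t).aemeasurable).2 ?_
    rw [← hw t]
    exact hWp t
  have happrox : ∀ (n : ℕ) (t : Fin T), ∃ z : (Set.Iic t → ℝ) → ℝ,
      eLpNorm (w t - z) (ENNReal.ofReal p) (P.map (Preorder.restrictLe t)) ≤
        ((n : ℝ≥0∞) + 1)⁻¹ ∧ ∃ K, LipschitzWith K z := fun n t => by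
    have : IsFiniteMeasure (P.map (Preorder.restrictLe t)) :=
      Measure.isFiniteMeasure_map P _
    exact exists_lipschitzWith_eLpNorm_sub_le _ ENNReal.ofReal_ne_top (hwp t)
      (ENNReal.inv_ne_zero.2 (by finiteness))
  choose z hz K hK using happrox
  have hzm : ∀ n t, Measurable (z n t) := fun n t => (hK n t).continuous.measurable
  set Z : ℕ → Path T → Path T := fun n x t => z n t (Preorder.restrictLe t x) with hZ
  have hle : ∀ n t, eLpNorm (fun x => Z n x t - W x t) (ENNReal.ofReal p) P ≤
      ((n : ℝ≥0∞) + 1)⁻¹ := fun n t => by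
    refine le_trans (le_of_eq ?_) (hz n t)
    rw [eLpNorm_map_measure ((hwm t).sub (hzm n t)).aestronglyMeasurable (hrm t).aemeasurable,
      ← eLpNorm_neg]
    congr 1
    ext x
    have := congrFun (hw t) x
    simp only [Function.comp_apply] at this
    simp [hZ, this]
  have hZp : ∀ n t, MemLp (fun x => Z n x t) (ENNReal.ofReal p) P := fun n t => by
    have hm : AEStronglyMeasurable (fun x => Z n x t - W x t) P :=
      (((hzm n t).comp (hrm t)).sub ((hWm t).mono ((canonicalFiltration T).le t)
        le_rfl)).aestronglyMeasurable
    have h1 : MemLp (fun x => Z n x t - W x t) (ENNReal.ofReal p) P :=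
      ⟨hm, (hle n t).trans_lt (by simp)⟩
    refine (h1.add (hWp t)).ae_eq (ae_of_all _ fun x => ?_)
    exact sub_add_cancel _ _
  have hlim : ∀ t, Tendsto (fun n => eLpNorm (fun x => Z n x t - W x t) (ENNReal.ofReal p) P)
      atTop (𝓝 0) := fun t => by
    refine tendsto_of_tendsto_of_tendsto_of_le_of_le tendsto_const_nhds ?_ (fun _ => zero_le)
      fun n => hle n t
    have := (ENNReal.tendsto_inv_nat_nhds_zero).comp (tendsto_add_atTop_nat 1)
    refine this.congr fun n => ?_
    simp
  have hnorm := tendsto_displacementNorm hp.le hZp hWp hlim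
  rw [hWn] at hnorm
  have hpair : Tendsto (fun n => ∑ t, ∫ x, g x t * Z n x t ∂P) atTop
      (𝓝 (displacementNorm q P g)) := by
    rw [← hWg]
    exact tendsto_finsetSum _ fun t _ =>
      tendsto_integral_mul hpq (memLp_pi_iff.1 hg t) (hZp · t) (hWp t) (hlim t)
  -- normalise the approximations
  have hθ : Tendsto (fun n => (max 1 (displacementNorm p P (Z n)))⁻¹) atTop (𝓝 1) := by
    have := (tendsto_const_nhds (x := (1 : ℝ))).max hnorm
    rw [max_self] at this
    simpa using this.inv₀ one_ne_zero
  have hfin := hθ.mul hpair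
  rw [one_mul] at hfin
  obtain ⟨n, hn⟩ := (hfin.eventually (le_mem_nhds (sub_lt_self _ hη))).exists
  set c := (max 1 (displacementNorm p P (Z n)))⁻¹ with hc
  have hm1 : 0 < max 1 (displacementNorm p P (Z n)) := lt_max_of_lt_left one_pos
  have hc0 : 0 ≤ c := (inv_pos.2 hm1).le
  refine ⟨fun t y => c * z n t y, c.toNNReal * ∑ t, K n t, fun t => ?_, ?_, ?_, ?_⟩
  · refine LipschitzWith.of_dist_le_mul fun y y' => ?_
    have h1 := (hK n t).dist_le_mul y y'
    have h2 : K n t ≤ ∑ t, K n t := Finset.single_le_sum (fun _ _ => zero_le) (Finset.mem_univ t)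
    have h2' : (K n t : ℝ) ≤ ((∑ t, K n t : NNReal) : ℝ) := NNReal.coe_le_coe.2 h2
    rw [Real.dist_eq] at h1
    rw [Real.dist_eq, ← mul_sub, abs_mul, abs_of_nonneg hc0, NNReal.coe_mul,
      Real.coe_toNNReal c hc0, mul_assoc]
    exact mul_le_mul_of_nonneg_left (h1.trans (mul_le_mul_of_nonneg_right h2' dist_nonneg)) hc0
  · exact memLp_pi_iff.2 fun t => (hZp n t).const_mul c
  · refine (displacementNorm_const_mul hp0 P hc0 (Z n)).trans_le ?_
    rw [hc, inv_mul_le_iff₀ hm1, mul_one]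
    exact le_max_right _ _
  · refine hn.trans (le_of_eq ?_)
    rw [Finset.mul_sum]
    refine Finset.sum_congr rfl fun t _ => ?_
    rw [← integral_const_mul]
    refine integral_congr_ae (ae_of_all _ fun x => ?_)
    simp only [hZ]
    ring

end Direction

/-! ### The lower bound -/

section LowerBound

variable {T : ℕ} {p q : ℝ} {f : Path T → Fin T → ℝ} {C : ℝ} {P Q : Measure (Path T)}

/-- A law is causal as soon as the past of the second coordinate is almost surely a function of the
past of the first. -/
lemma isCausal_of_forall_exists {π : Measure (Path T × Path T)} [IsFiniteMeasure π]
    (h : ∀ (t : Fin T) (A : Set (Set.Iic t → ℝ)), MeasurableSet A →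
      ∃ S : Set (Path T), MeasurableSet[canonicalFiltration T t] S ∧
        {z : Path T × Path T | (fun s : Set.Iic t => z.2 s) ∈ A} =ᵐ[π] Prod.fst ⁻¹' S) :
    IsCausal π := by
  intro t A hA
  obtain ⟨S, hS, hAS⟩ := h t A hA
  have hFle := (canonicalFiltration T).le t
  have hle : MeasurableSpace.comap (Prod.fst : Path T × Path T → Path T) MeasurableSpace.pi ≤
      Prod.instMeasurableSpace := measurable_fst.comap_le
  have hind := indicator_ae_eq_of_ae_eq_set (f := fun _ => (1 : ℝ)) hAS
  have hcond : ∀ m : MeasurableSpace (Path T × Path T),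
      m ≤ Prod.instMeasurableSpace → MeasurableSet[m] (Prod.fst ⁻¹' S) →
      π⟦{z : Path T × Path T | (fun s : Set.Iic t => z.2 s) ∈ A} | m⟧ =ᵐ[π]
        (Prod.fst ⁻¹' S).indicator fun _ => (1 : ℝ) := fun m hm hSm => by
    refine (condExp_congr_ae hind).trans ?_
    rw [condExp_of_stronglyMeasurable hm (stronglyMeasurable_const.indicator hSm)
      ((integrable_const _).indicator (hm _ hSm))]
  exact (hcond _ hle ⟨S, hFle _ hS, rfl⟩).trans
    (hcond _ ((MeasurableSpace.comap_mono hFle).trans hle) ⟨S, hS, rfl⟩).symm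

/-- The adapted perturbation `x_t ↦ x_t + r z_t(x_1, …, x_t)`. -/
def perturb (z : ∀ t : Fin T, (Set.Iic t → ℝ) → ℝ) (r : ℝ) (x : Path T) : Path T :=
  fun t => x t + r * z t (Preorder.restrictLe t x)

/-- The action of `perturb` on paths up to time `t`. -/
def perturbLe (z : ∀ t : Fin T, (Set.Iic t → ℝ) → ℝ) (r : ℝ) (t : Fin T) (y : Set.Iic t → ℝ) :
    Set.Iic t → ℝ :=
  fun s => y s + r * z s (Preorder.restrictLe₂ (π := fun _ : Fin T => ℝ) s.2 y)

lemma measurable_perturbLe {z : ∀ t : Fin T, (Set.Iic t → ℝ) → ℝ} (hz : ∀ t, Measurable (z t))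
    (r : ℝ) (t : Fin T) : Measurable (perturbLe z r t) :=
  measurable_pi_iff.2 fun s => (measurable_pi_apply s).add
    (((hz s).comp (Preorder.measurable_restrictLe₂ _)).const_mul r)

lemma measurable_perturb {z : ∀ t : Fin T, (Set.Iic t → ℝ) → ℝ} (hz : ∀ t, Measurable (z t))
    (r : ℝ) : Measurable (perturb z r) :=
  measurable_pi_iff.2 fun t => (measurable_pi_apply t).add
    (((hz t).comp (Preorder.measurable_restrictLe t)).const_mul r)

lemma measurableSet_preimage_perturb {z : ∀ t : Fin T, (Set.Iic t → ℝ) → ℝ}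
    (hz : ∀ t, Measurable (z t)) (r : ℝ) {t : Fin T} {S : Set (Path T)}
    (hS : MeasurableSet[canonicalFiltration T t] S) :
    MeasurableSet[canonicalFiltration T t] (perturb z r ⁻¹' S) := by
  obtain ⟨A, hA, rfl⟩ := hS
  exact ⟨perturbLe z r t ⁻¹' A, measurable_perturbLe hz r t hA, rfl⟩

/-- A perturbation by a Lipschitz functional is injective for small `r`. -/
lemma injective_perturbLe {z : ∀ t : Fin T, (Set.Iic t → ℝ) → ℝ} {K : NNReal}
    (hz : ∀ t, LipschitzWith K (z t)) {r : ℝ} (hr : 0 ≤ r) (hrK : r * K < 1) (t : Fin T) :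
    Function.Injective (perturbLe z r t) := by
  intro y y' h
  have hle : dist y y' ≤ r * K * dist y y' := by
    refine (dist_pi_le_iff (by positivity)).2 fun s => ?_
    have hs := congrFun h s
    simp only [perturbLe] at hs
    have h1 := (hz s).dist_le_mul (Preorder.restrictLe₂ (π := fun _ : Fin T => ℝ) s.2 y)
      (Preorder.restrictLe₂ (π := fun _ : Fin T => ℝ) s.2 y')
    have h2 : dist (Preorder.restrictLe₂ (π := fun _ : Fin T => ℝ) s.2 y)
        (Preorder.restrictLe₂ (π := fun _ : Fin T => ℝ) s.2 y') ≤ dist y y' :=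
      (dist_pi_le_iff dist_nonneg).2 fun u => dist_le_pi_dist y y' ⟨u, _⟩
    rw [Real.dist_eq] at h1 ⊢
    have h3 : y s - y' s = -(r * (z s (Preorder.restrictLe₂ (π := fun _ : Fin T => ℝ) s.2 y) -
        z s (Preorder.restrictLe₂ (π := fun _ : Fin T => ℝ) s.2 y'))) := by linarith
    rw [h3, abs_neg, abs_mul, abs_of_nonneg hr, mul_assoc]
    exact mul_le_mul_of_nonneg_left (h1.trans (mul_le_mul_of_nonneg_left h2 K.2)) hr
  have h0 : dist y y' ≤ 0 := by nlinarith [dist_nonneg (x := y) (y := y')]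
  exact dist_le_zero.1 h0

/-- The coupling of `X` with its perturbation is bicausal: the perturbation is adapted, and since
it is injective on paths up to each time `t`, the past of `X` is conversely a measurable function
of the past of the perturbation. -/
lemma isBicausal_perturb [IsProbabilityMeasure P] {z : ∀ t : Fin T, (Set.Iic t → ℝ) → ℝ}
    {K : NNReal} (hz : ∀ t, LipschitzWith K (z t)) {r : ℝ} (hr : 0 ≤ r) (hrK : r * K < 1) :
    IsBicausal (P.map fun x => (x, perturb z r x)) := by
  have hzm : ∀ t, Measurable (z t) := fun t => (hz t).continuous.measurable
  have hΦ := measurable_perturb hzm r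
  have hm1 : Measurable fun x => (x, perturb z r x) := measurable_id.prodMk hΦ
  have hm2 : Measurable fun x => (perturb z r x, x) := hΦ.prodMk measurable_id
  have hA2 : ∀ {t : Fin T} {A : Set (Set.Iic t → ℝ)}, MeasurableSet A →
      MeasurableSet {y : Path T × Path T | (fun s : Set.Iic t => y.2 s) ∈ A} := fun {t A} hA =>
    measurable_snd ((Preorder.measurable_restrictLe t) hA)
  have hev : ∀ {g : Path T → Path T × Path T} (_ : Measurable g) {E F : Set (Path T × Path T)}
      (_ : MeasurableSet E) (_ : MeasurableSet F), (∀ x, g x ∈ E ↔ g x ∈ F) →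
      E =ᵐ[P.map g] F := fun {g} hg {E F} hE hF h => by
    rw [eventuallyEq_set, ae_map_iff hg.aemeasurable
      (measurableSet_setOfPred.2 (hE.mem.iff hF.mem))]
    exact ae_of_all _ h
  have hFle := (canonicalFiltration T).le
  constructor
  · have := Measure.isProbabilityMeasure_map (μ := P) hm1.aemeasurable
    refine isCausal_of_forall_exists fun t A hA =>
      ⟨perturb z r ⁻¹' (Preorder.restrictLe t ⁻¹' A),
        measurableSet_preimage_perturb hzm r ⟨A, hA, rfl⟩, ?_⟩
    exact hev hm1 (hA2 hA) (measurable_fst (hFle t _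
      (measurableSet_preimage_perturb hzm r ⟨A, hA, rfl⟩))) fun x => Iff.rfl
  · rw [Measure.map_map measurable_swap hm1]
    change IsCausal (P.map fun x => (perturb z r x, x))
    have := Measure.isProbabilityMeasure_map (μ := P) hm2.aemeasurable
    have hinj := injective_perturbLe hz hr hrK
    refine isCausal_of_forall_exists fun t A hA => ?_
    have hS : MeasurableSet (perturbLe z r t '' A) :=
      ((measurable_perturbLe hzm r t).measurableEmbedding (hinj t)).measurableSet_image.2 hA
    refine ⟨Preorder.restrictLe t ⁻¹' (perturbLe z r t '' A), ⟨_, hS, rfl⟩,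
      hev hm2 (hA2 hA) (measurable_fst (hFle t _ ⟨_, hS, rfl⟩)) fun x => ?_⟩
    exact ((hinj t).mem_set_image (s := A) (a := Preorder.restrictLe t x)).symm

lemma map_perturb_mem_adaptedBall (hp : 0 < p) (hP : P ∈ finiteMomentLaws T p)
    {z : ∀ t : Fin T, (Set.Iic t → ℝ) → ℝ} {K : NNReal} (hz : ∀ t, LipschitzWith K (z t))
    (hZ : MemLp (fun x t => z t (Preorder.restrictLe t x)) (ENNReal.ofReal p) P)
    (hZ1 : displacementNorm p P (fun x t => z t (Preorder.restrictLe t x)) ≤ 1)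
    {r : ℝ} (hr : 0 ≤ r) (hrK : r * K < 1) : P.map (perturb z r) ∈ adaptedBall p P r := by
  have hPp := hP.1
  have hzm : ∀ t, Measurable (z t) := fun t => (hz t).continuous.measurable
  have hΦ := measurable_perturb hzm r
  have hm : Measurable fun x => (x, perturb z r x) := measurable_id.prodMk hΦ
  have hΔm : Measurable fun y : Path T × Path T => y.2 - y.1 := measurable_snd.sub measurable_fst
  have hΔ : ∀ x, perturb z r x - x = r • fun t => z t (Preorder.restrictLe t x) := fun x => by
    ext t; simp [perturb]
  have hmom : P.map (perturb z r) ∈ finiteMomentLaws T p := by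
    refine ⟨Measure.isProbabilityMeasure_map hΦ.aemeasurable, ?_⟩
    refine (memLp_map_measure_iff measurable_id.aestronglyMeasurable hΦ.aemeasurable).2 ?_
    exact hP.2.add (hZ.const_smul r)
  have hcoup : IsCoupling P (P.map (perturb z r)) (P.map fun x => (x, perturb z r x)) := by
    constructor
    · rw [Measure.map_map measurable_fst hm]
      exact Measure.map_id
    · rw [Measure.map_map measurable_snd hm]
      rfl
  refine ⟨hmom, (iInf₂_le _ ⟨hcoup, isBicausal_perturb hz hr hrK⟩).trans ?_⟩
  obtain ⟨hX, hY⟩ := hcoup.memLp hP hmom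
  rw [transportCost_eq hp (hY.sub hX)]
  refine ENNReal.ofReal_le_ofReal ?_
  have h1 : displacementNorm p (P.map fun x => (x, perturb z r x)) (fun y => y.2 - y.1) =
      displacementNorm p P (fun x t => r * z t (Preorder.restrictLe t x)) := by
    simp only [displacementNorm]
    congr 1
    refine Finset.sum_congr rfl fun t _ => ?_
    have hm2 : AEStronglyMeasurable (fun y : Path T × Path T => |(y.2 - y.1) t| ^ p)
        (P.map fun x => (x, perturb z r x)) :=
      (((measurable_pi_apply t).comp hΔm).abs.pow_const p).aestronglyMeasurable
    rw [integral_map hm.aemeasurable hm2]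
    simp only [hΔ]
    rfl
  rw [h1, displacementNorm_const_mul hp P hr]
  exact mul_le_of_le_one_right hr hZ1

lemma integral_mul_condExp_eq [IsFiniteMeasure P] {m : MeasurableSpace (Path T)}
    (hm : m ≤ MeasurableSpace.pi) {g k : Path T → ℝ}
    (hk : Measurable[m] k) (hg : Integrable g P) (hkg : Integrable (fun x => k x * g x) P) :
    ∫ x, k x * g x ∂P = ∫ x, k x * (P[g | m]) x ∂P := by
  have h1 := condExp_mul_of_stronglyMeasurable_left (μ := P) hk.stronglyMeasurable hkg hg
  have h2 := integral_condExp (μ := P) hm (f := k * g)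
  rw [integral_congr_ae h1] at h2
  exact h2.symm

/-- First-order lower bound: the law of the perturbation of `X` in a nearly optimal Lipschitz
direction `Z` has a large stopping value. A stopping time of the perturbation is a stopping time
`σ` of `X`; either `σ` is far from optimal and the zeroth order term wins, or `σ` agrees with
`τstar` outside a small set and the first-order term is close to that of `τstar`. -/
theorem exists_le_stoppingValue (hpq : p.HolderConjugate q)
    (hC1 : ∀ t : Fin T, ContDiff ℝ 1 (fun x => f x t)) (hC : 0 ≤ C)
    (hG : ∀ k x, ‖pathDeriv f k x‖ ≤ C * (1 + ‖x‖ ^ (p - 1)))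
    (hP : P ∈ finiteMomentLaws T p) {τstar : Path T → Fin T}
    (hτ_opt : IsOptimalStoppingTime f P τstar)
    (hτ_unique : ∀ τ : Path T → Fin T, IsOptimalStoppingTime f P τ → τ =ᵐ[P] τstar)
    {ε : ℝ} (hε : 0 < ε) :
    ∃ δ : ℝ, 0 < δ ∧ ∀ r : ℝ, 0 ≤ r → r < δ → ∃ Q ∈ adaptedBall p P r,
      stoppingValue f P + r * (sensitivity q f P τstar - ε) ≤ stoppingValue f Q := by
  have hp := hpq.lt
  have hp0 := hpq.pos
  have hPp := hP.1
  have hτm := measurable_of_mem_stoppingTimes hτ_opt.1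
  have hε3 : 0 < ε / 3 := by positivity
  set V := sensitivity q f P τstar with hVdef
  have hV : 0 ≤ V := displacementNorm_nonneg
  have hĝ : ∀ t, MemLp (projectedDeriv f P τstar t) (ENNReal.ofReal q) P := fun t =>
    memLp_projectedDeriv hpq hC1 hG hP.2 hτm t
  obtain ⟨z, K, hz, hZ, hZ1, hdual⟩ := exists_lipschitz_direction hpq
    (g := fun x t => projectedDeriv f P τstar t x)
    (fun t => stronglyMeasurable_condExp.measurable) (memLp_pi_iff.2 hĝ) hε3
  have hzm : ∀ t, Measurable (z t) := fun t => (hz t).continuous.measurable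
  set Z : Path T → Path T := fun x t => z t (Preorder.restrictLe t x) with hZdef
  have hZm : Measurable Z := measurable_pi_iff.2 fun t =>
    (hzm t).comp (Preorder.measurable_restrictLe t)
  have hZt : ∀ t, Measurable[canonicalFiltration T t] fun x => Z x t := fun t =>
    (hzm t).comp (comap_measurable _)
  set h : Path T → ℝ := fun x => C * (1 + ‖x‖ ^ (p - 1)) * ‖Z x‖ with hh
  have hhi : Integrable h P := integrable_mul_of_holderConjugate hpq.symm
    ((memLp_one_add_norm_rpow hpq hP.2).const_mul C) hZ.norm
  have hDh : ∀ k x, |pathDeriv f k x (Z x)| ≤ h x := fun k x =>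
    ((pathDeriv f k x).le_opNorm _).trans
      (mul_le_mul_of_nonneg_right (hG k x) (norm_nonneg _))
  have hDi : ∀ σ : Path T → Fin T, Measurable σ →
      Integrable (fun x => pathDeriv f (σ x) x (Z x)) P := fun σ hσ =>
    integrable_pathDeriv_apply hpq hC1 hG measurable_id hP.2 hZm hZ hσ
  set B := ∫ x, h x ∂P with hB
  have hB0 : 0 ≤ B := integral_nonneg fun x => by positivity
  obtain ⟨δ₁, hδ₁, hrem⟩ := exists_integral_remainder_le hpq hC1 hC hG hP.2 hε3
  obtain ⟨δ₂, hδ₂, hstab⟩ := exists_integral_ne_lt hp hC1 hC hG hP hτ_opt hτ_unique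
    (hhi.const_mul 2) hε3
  -- the first-order term of `τstar` in the direction `Z`
  have hstar : V - ε / 3 ≤ ∫ x, pathDeriv f (τstar x) x (Z x) ∂P := by
    refine hdual.trans (le_of_eq ?_)
    have hg := fun t => memLp_partialDeriv hpq hC1 hG hP.2 hτm t
    have hi : ∀ t, Integrable (fun x => Z x t * partialDeriv f t x (τstar x)) P := fun t =>
      integrable_mul_of_holderConjugate hpq (memLp_pi_iff.1 hZ t) (hg t).2
    have hsum : ∫ x, pathDeriv f (τstar x) x (Z x) ∂P =
        ∑ t, ∫ x, Z x t * partialDeriv f t x (τstar x) ∂P := by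
      rw [← integral_finsetSum _ fun t _ => hi t]
      simp only [pathDeriv_apply hC1, mul_comm]
    rw [hsum]
    refine Finset.sum_congr rfl fun t _ => ?_
    rw [integral_mul_condExp_eq ((canonicalFiltration T).le t) (hZt t)
      ((hg t).2.integrable (by
        rw [← ENNReal.ofReal_one]; exact ENNReal.ofReal_le_ofReal hpq.symm.lt.le)) (hi t)]
    simp only [mul_comm, projectedDeriv, hZdef]
  set δ₃ := δ₂ / (V + B + ε) with hδ₃
  have hδ₃0 : 0 < δ₃ := by positivity
  refine ⟨min (min δ₁ δ₃) (1 / ((K : ℝ) + 1)), by positivity, fun r hr hrδ => ?_⟩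
  have hr1 : r < δ₁ := hrδ.trans_le ((min_le_left _ _).trans (min_le_left _ _))
  have hr3 : r < δ₃ := hrδ.trans_le ((min_le_left _ _).trans (min_le_right _ _))
  have hrK : r * K < 1 := by
    have h1 : r < 1 / ((K : ℝ) + 1) := hrδ.trans_le (min_le_right _ _)
    rw [lt_div_iff₀ (by positivity)] at h1
    linarith
  have hΦ := measurable_perturb hzm r
  have hΔ : ∀ x, perturb z r x - x = r • Z x := fun x => by
    ext t; simp [perturb, hZdef]
  have hQ := map_perturb_mem_adaptedBall hp0 hP hz hZ hZ1 hr hrK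
  refine ⟨P.map (perturb z r), hQ, ?_⟩
  have : Nonempty (stoppingTimes T) := ⟨⟨τstar, hτ_opt.1⟩⟩
  refine le_ciInf fun ⟨τ, hτ⟩ => ?_
  have hτm' := measurable_of_mem_stoppingTimes hτ
  set σ : Path T → Fin T := fun x => τ (perturb z r x) with hσ
  have hσS : σ ∈ stoppingTimes T := by
    rw [mem_stoppingTimes] at hτ ⊢
    exact fun t => measurableSet_preimage_perturb hzm r (hτ t)
  have hσm := measurable_of_mem_stoppingTimes hσS
  have hm : AEStronglyMeasurable (fun x : Path T => f x (τ x)) (P.map (perturb z r)) :=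
    (measurable_eval_index (g := fun k x => f x k)
      (fun k => (hC1 k).continuous.measurable) measurable_id hτm').aestronglyMeasurable
  rw [integral_map hΦ.aemeasurable hm]
  change _ ≤ ∫ x, f (perturb z r x) (σ x) ∂P
  have hΦp : MemLp (perturb z r) (ENNReal.ofReal p) P := hP.2.add (hZ.const_smul r)
  have hΔp : MemLp (fun x => perturb z r x - x) (ENNReal.ofReal p) P := hΦp.sub hP.2
  have hL : (∫ x, ‖perturb z r x - x‖ ^ p ∂P) ^ (1 / p) ≤ r := by
    refine (integral_norm_rpow_rpow_le hp0 hΔp).trans ?_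
    simp only [hΔ]
    exact (displacementNorm_const_mul hp0 P hr Z).trans_le (mul_le_of_le_one_right hr hZ1)
  have h1 := hrem P (fun x => x) (perturb z r) σ measurable_id hΦ hσm Measure.map_id hΔp
    (hL.trans hr1.le)
  have i1 : Integrable (fun x => f (perturb z r x) (σ x)) P :=
    integrable_payoff hp hC1 hC hG hΦ hΦp hσm
  have i2 : Integrable (fun x => f x (σ x)) P :=
    integrable_payoff hp hC1 hC hG measurable_id hP.2 hσm
  have i12 : Integrable (fun x => f (perturb z r x) (σ x) - f x (σ x)) P := i1.sub i2
  have hD : ∀ x, pathDeriv f (σ x) x (perturb z r x - x) = r * pathDeriv f (σ x) x (Z x) :=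
    fun x => by rw [hΔ, map_smul, smul_eq_mul]
  simp only [hD] at h1
  rw [integral_sub i12 ((hDi σ hσm).const_mul r), integral_sub i1 i2, integral_const_mul] at h1
  have h2 := (abs_le.1 h1).1
  have h3 := mul_le_mul_of_nonneg_left hL hε3.le
  rcases lt_or_ge (∫ x, f x (σ x) ∂P) (stoppingValue f P + δ₂) with hcase | hcase
  · have h4 := hstab σ hσS hcase
    have hS : MeasurableSet {x | σ x ≠ τstar x} := (measurableSet_eq_fun hσm hτm).compl
    have h5 : ∫ x, pathDeriv f (τstar x) x (Z x) ∂P - ∫ x, pathDeriv f (σ x) x (Z x) ∂P ≤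
        ∫ x, Set.indicator {x | σ x ≠ τstar x} (fun x => 2 * h x) x ∂P := by
      rw [← integral_sub (hDi _ hτm) (hDi _ hσm)]
      refine integral_mono ((hDi _ hτm).sub (hDi _ hσm)) ((hhi.const_mul 2).indicator hS)
        fun x => ?_
      by_cases hx : σ x = τstar x
      · simp [hx]
      · rw [Set.indicator_of_mem (by exact hx)]
        have := (abs_le.1 (hDh (τstar x) x)).2
        have := (abs_le.1 (hDh (σ x) x)).1
        linarith
    have h6 := stoppingValue_le hp hC1 hC hG hP hσS
    have h7 : r * (V - ε / 3 - ε / 3) ≤ r * ∫ x, pathDeriv f (σ x) x (Z x) ∂P :=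
      mul_le_mul_of_nonneg_left (by linarith) hr
    linarith
  · have h4 : ‖∫ x, pathDeriv f (σ x) x (Z x) ∂P‖ ≤ B :=
      norm_integral_le_of_norm_le hhi (ae_of_all _ fun x => hDh _ _)
    rw [Real.norm_eq_abs] at h4
    have h5 := mul_le_mul_of_nonneg_left (abs_le.1 h4).1 hr
    have h6 : r * (V + B + ε) < δ₂ := (lt_div_iff₀ (by positivity)).1 hr3
    have h7 := mul_nonneg hr hε.le
    linarith

end LowerBound

end AdaptedStopping

end

theorem theorem4 (T : ℕ) (p q : ℝ) (hp : 1 < p) (hq : q = p / (p - 1))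
    (P : Measure (AdaptedStopping.Path T))
    (hP : P ∈ AdaptedStopping.finiteMomentLaws T p)
    (f : AdaptedStopping.Path T → Fin T → ℝ)
    (hf_adapted : ∀ t : Fin T,
      Measurable[AdaptedStopping.canonicalFiltration T t] (fun x => f x t))
    (hf_C1 : ∀ t : Fin T, ContDiff ℝ 1 (fun x => f x t))
    (hf_growth : ∃ c : ℝ, 0 < c ∧ ∀ (x : AdaptedStopping.Path T) (t : Fin T),
      ∑ s : Fin T, |AdaptedStopping.partialDeriv f s x t|
        ≤ c * (1 + ∑ s : Fin T, |x s| ^ (p - 1)))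
    (τstar : AdaptedStopping.Path T → Fin T)
    (hτ_opt : AdaptedStopping.IsOptimalStoppingTime f P τstar)
    (hτ_unique : ∀ τ : AdaptedStopping.Path T → Fin T,
      AdaptedStopping.IsOptimalStoppingTime f P τ → τ =ᵐ[P] τstar) :
    -- all quantities in the expansion are well defined and finite
    (∀ Q ∈ AdaptedStopping.finiteMomentLaws T p,
      (∀ τ ∈ AdaptedStopping.stoppingTimes T, Integrable (fun x => f x (τ x)) Q) ∧
      BddBelow (Set.range fun τ : AdaptedStopping.stoppingTimes T =>
        ∫ x, f x (τ.1 x) ∂Q)) ∧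
    (∀ r : ℝ, 0 ≤ r → BddAbove
      (AdaptedStopping.stoppingValue f '' AdaptedStopping.adaptedBall p P r)) ∧
    (∀ t : Fin T,
      Integrable (fun x => AdaptedStopping.partialDeriv f t x (τstar x)) P ∧
      Integrable (fun x => |AdaptedStopping.projectedDeriv f P τstar t x| ^ q) P) ∧
    -- the first-order expansion as `r ↓ 0`
    (fun r : ℝ =>
      sSup (AdaptedStopping.stoppingValue f '' AdaptedStopping.adaptedBall p P r)
        - (AdaptedStopping.stoppingValue f P
          + r * (∑ t : Fin T,
              ∫ x, |AdaptedStopping.projectedDeriv f P τstar t x| ^ q ∂P) ^ (1 / q)))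
      =o[𝓝[>] 0] (fun r : ℝ => r) := by

  have hpq : p.HolderConjugate q := by
    rw [hq]
    exact Real.HolderConjugate.conjExponent hp
  obtain ⟨C, hC, hG⟩ := AdaptedStopping.exists_norm_pathDeriv_le hp hf_C1 hf_growth
  have hPp := hP.1
  have hτm := AdaptedStopping.measurable_of_mem_stoppingTimes hτ_opt.1
  have hq1 : 1 ≤ ENNReal.ofReal q := by
    rw [← ENNReal.ofReal_one]; exact ENNReal.ofReal_le_ofReal hpq.symm.lt.le
  have hbdd : ∀ r : ℝ, 0 ≤ r → BddAbove
      (AdaptedStopping.stoppingValue f '' AdaptedStopping.adaptedBall p P r) := fun r hr =>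
    AdaptedStopping.bddAbove_stoppingValue hp hf_C1 hC hG hP (τstar 0) hr
  refine ⟨fun Q hQ => ⟨fun τ hτ => ?_, AdaptedStopping.bddBelow_stopping hp hf_C1 hC hG hQ⟩, hbdd,
    fun t => ⟨(AdaptedStopping.memLp_partialDeriv hpq hf_C1 hG hP.2 hτm t).2.integrable hq1,
      AdaptedStopping.integrable_norm_rpow hpq.symm.pos
        (AdaptedStopping.memLp_projectedDeriv hpq hf_C1 hG hP.2 hτm t)⟩, ?_⟩
  · have hQp := hQ.1
    exact AdaptedStopping.integrable_payoff hp hf_C1 hC hG measurable_id hQ.2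
      (AdaptedStopping.measurable_of_mem_stoppingTimes hτ)
  · refine isLittleO_iff.2 fun ε hε => ?_
    obtain ⟨δ₁, hδ₁, hup⟩ :=
      AdaptedStopping.exists_stoppingValue_le hpq hf_C1 hC hG hP hτ_opt hε
    obtain ⟨δ₂, hδ₂, hlow⟩ :=
      AdaptedStopping.exists_le_stoppingValue hpq hf_C1 hC hG hP hτ_opt hτ_unique hε
    filter_upwards [Ioo_mem_nhdsGT (lt_min hδ₁ hδ₂)] with r hr
    obtain ⟨Q, hQ, hQlow⟩ := hlow r hr.1.le (hr.2.trans_le (min_le_right _ _))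
    have h1 : sSup (AdaptedStopping.stoppingValue f '' AdaptedStopping.adaptedBall p P r) ≤
        AdaptedStopping.stoppingValue f P + r * (AdaptedStopping.sensitivity q f P τstar + ε) := by
      refine csSup_le ⟨_, Q, hQ, rfl⟩ ?_
      rintro _ ⟨Q', hQ', rfl⟩
      exact hup r hr.1.le (hr.2.trans_le (min_le_left _ _)) Q' hQ'
    have h2 := hQlow.trans (le_csSup (hbdd r hr.1.le) ⟨Q, hQ, rfl⟩)
    rw [Real.norm_eq_abs, Real.norm_of_nonneg hr.1.le, abs_le]
    change -(ε * r) ≤ _ - (_ + r * AdaptedStopping.sensitivity q f P τstar) ∧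
      _ - (_ + r * AdaptedStopping.sensitivity q f P τstar) ≤ ε * r
    constructor <;> linarith
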